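/- Fix $N\ge 2$. Let $\mathbf P=\mathbb C[t_1,\dots,t_N]$, let $\mathrm{loc}\subset\mathbf P$ be the multiplicative set of products of differences $t_a-t_b$ with $a\ne b$ in $\{1,\dots,N\}$, and let $(\cdot)^{loc}$ denote localisation at $\mathrm{loc}$. For $0\le n\le N$ let $\Lambda_n$ be the set of words $\lambda\in\{0,1\}^N$ with exactly $n$ letters $1$, and $\Lambda=\bigcup_n\Lambda_n$. The symmetric group acts on words by $(w\lambda)_j=\lambda_{w^{-1}(j)}$. *Algebraic side.* Let $V=\mathbb C^2$ with basis $v_0,v_1$, and let $\mathbb V_N=V^{\otimes N}\otimes\mathbf P$ with $\mathbf P$-basis $v_\lambda=v_{\lambda_1}\otimes\cdots\otimes v_{\lambda_N}$, $\lambda\in\Lambda$. Let $$L(x,t)=\begin{pmatrix}1&0&0&0\\0&x+t&1&0\\0&1&0&0\\0&0&0&1\end{pmatrix}$$ act on $V\otimes V$ in the ordered basis $v_0\otimes v_0,\,v_0\otimes v_1,\,v_1\otimes v_0,\,v_1\otimes v_1$. Let $M(x)=L_{0N}(x,t_N)\cdots L_{02}(x,t_2)L_{01}(x,t_1)$, acting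 on $V\otimes\mathbb V_N[x]$ (with tensor factors numbered $0,1,\dots,N$), and write $M(x)=\begin{pmatrix}A(x)&B(x)\\C(x)&D(x)\end{pmatrix}$ with respect to the $0$th factor. For $\lambda\in\Lambda$ with $\{i\mid\lambda_i=0\}=\{i_1<\dots<i_k\}$, the normalised Bethe vector is $$\mathbb b_\lambda=\prod_{a,b:\ \lambda_a=1,\ \lambda_b=0}(t_a-t_b)^{-1}\;C(-t_{i_1})\cdots C(-t_{i_k})\,v_{(1,\dots,1)}\in\mathbb V_N^{loc}.$$ *Geometric side.* Let $X_n=\mathrm{Gr}(n,N)$ be the Grassmannian of $n$-dimensional subspaces of $\mathbb C^N$ and $T$ the torus of invertible diagonal matrices. The $T$-fixed points of $X_n$ are the coordinate planes $\mathbf w_\lambda=\operatorname{span}(e_i\mid\lambda_i=1)$, $\lambda\in\Lambda_n$. By restriction to the fixed points, $H_T^*(X_n)$ is identified with the $\mathbf P$-module of GKM classes, i.e. of the functions $\alpha:X_n^T\to\mathbf P$, written $\alpha(\lambda)=\alpha(\mathbf w_\lambda)$, such that $t_i-t_j$ divides $\alpha(\lambda)-\alpha(\mu)$ whenever $\mu=s_{ij}\lambda$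 for a transposition $s_{ij}$. For $\lambda,\mu\in\Lambda_n$ write $\mu\ge\lambda$ if $\sum_{i\le j}\mu_i\ge\sum_{i\le j}\lambda_i$ for all $j$, and, for a permutation $w$, write $\mu\ge_w\lambda$ if $w^{-1}\mu\ge w^{-1}\lambda$. Let $\operatorname{inv}_w(\lambda)=\{(i,j)\mid w^{-1}(i)<w^{-1}(j),\ \lambda_i>\lambda_j\}$ and let $\ell(\lambda)$ be the number of pairs $i<j$ with $\lambda_i>\lambda_j$. The $w$-twisted Schubert class $S^w_\lambda$ of $\lambda\in\Lambda_n$ is the unique GKM class such that 1. $S^w_\lambda(\lambda)\neq0$, and $S^w_\lambda(\mu)\ne0$ implies $\mu\ge_w\lambda$; 2. $S^w_\lambda(\lambda)=\prod_{(i,j)\in\operatorname{inv}_w(\lambda)}(t_i-t_j)$; 3. $\deg S^w_\lambda(\mu)=\ell(w^{-1}\lambda)$ for all $\mu\ge_w\lambda$, where $\deg$ is the total degree. Let $\omega_0$ be the longest permutation $i\mapsto N+1-i$. **Corollary.** The classes $S^{\omega_0}_\lambda$ exist and are unique, restriction to the fixed points induces isomorphisms $H_T^*(X_n)^{loc}\cong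 \mathrm{Maps}(X_n^T,\mathbf P)^{loc}$ for $0\le n\le N$, and there is a unique $\mathbf P^{loc}$-linear map $$\Psi:\ \mathbb V_N^{loc}\longrightarrow\bigoplus_{n=0}^N H_T^*(X_n)^{loc},\qquad \Psi(v_\lambda)=S^{\omega_0}_\lambda\quad(\lambda\in\Lambda).$$ The map $\Psi$ is an isomorphism, and for every $\lambda\in\Lambda$ $$\Psi(\mathbb b_\lambda)=\mathbb 1_{\mathbf w_\lambda},$$ where $\mathbb 1_{p}$, $p\in X_n^T$, denotes the fixed point basis vector, $\mathbb 1_p(p')=\delta_{p,p'}$. -/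

import Mathlib

open scoped TensorProduct

namespace BetheGr

noncomputable section

/-! ### Words, polynomials, permutations -/

/-- The polynomial ring `P = ℂ[t_1, …, t_N]`; the variable `t_i` is `MvPolynomial.X i`. -/
abbrev P (N : ℕ) : Type := MvPolynomial (Fin N) ℂ

/-- `Λ = {0,1}^N`. -/
abbrev Word (N : ℕ) : Type := Fin N → Fin 2

/-- `Λ_n`: the words of length `N` with exactly `n` letters `1`. -/
abbrev WordOf (N n : ℕ) : Type := {l : Word N // ∑ i, (l i : ℕ) = n}

/-- The action of permutations on words, `(w λ)_j = λ_{w⁻¹ j}`. -/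
def permWord {N : ℕ} (w : Equiv.Perm (Fin N)) (l : Word N) : Word N := fun j => l (w⁻¹ j)

/-- The multiplicative set `loc` of all products of the differences `t_a - t_b`, `a ≠ b`. -/
def loc (N : ℕ) : Submonoid (P N) :=
  Submonoid.closure {f | ∃ a b : Fin N, a ≠ b ∧ f = MvPolynomial.X a - MvPolynomial.X b}

/-! ### The algebraic side: `V^{⊗N} ⊗ P`, the monodromy matrix, Bethe vectors -/

/-- `𝕍_N = V^{⊗N} ⊗ P` with `V = ℂ²`, as a `P`-module. -/
abbrev VN (N : ℕ) : Type := P N ⊗[ℂ] (⨂[ℂ] _ : Fin N, (Fin 2 → ℂ))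

/-- The standard (spin) basis `v_λ = v_{λ_1} ⊗ ⋯ ⊗ v_{λ_N}` of the `P`-module `𝕍_N`. -/
def vBasis (N : ℕ) : Module.Basis (Word N) (P N) (VN N) :=
  (Basis.piTensorProduct fun _ : Fin N => Pi.basisFun ℂ (Fin 2)).baseChange (P N)

/-- The Lax matrix `L(x,t)`, an endomorphism of `V ⊗ V`, in the ordered basis
`v_0 ⊗ v_0, v_0 ⊗ v_1, v_1 ⊗ v_0, v_1 ⊗ v_1`; the row is the output, the column the input. -/
def lax {R : Type*} [CommRing R] (x t : R) : Matrix (Fin 2 × Fin 2) (Fin 2 × Fin 2) R :=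
  fun p q =>
    (!![1, 0, 0, 0;
        0, x + t, 1, 0;
        0, 1, 0, 0;
        0, 0, 0, 1] : Matrix (Fin 4) (Fin 4) R) (finProdFinEquiv p) (finProdFinEquiv q)

/-- `L_{0j}(x,t)`: acts as `L(x,t)` on the `0`-th and `j`-th tensor factors and as the identity on
the others, as a matrix in the basis `v_a ⊗ v_λ`. -/
def lax0 {R : Type*} [CommRing R] {N : ℕ} (j : Fin N) (x t : R) :
    Matrix (Fin 2 × Word N) (Fin 2 × Word N) R :=
  fun p q => if ∀ i, i ≠ j → p.2 i = q.2 i then lax x t (p.1, p.2 j) (q.1, q.2 j) else 0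

/-- The monodromy matrix `M(x,t_1,…,t_N) = L_{0N}(x,t_N) ⋯ L_{02}(x,t_2) L_{01}(x,t_1)`. -/
def monodromy {R : Type*} [CommRing R] {N : ℕ} (x : R) (t : Fin N → R) :
    Matrix (Fin 2 × Word N) (Fin 2 × Word N) R :=
  ((List.finRange N).reverse.map fun j => lax0 j x (t j)).prod

/-- The operator `C(y) ∈ End_P(𝕍_N)`, `y ∈ P`: the lower left block of the monodromy matrix
`M = (A B; C D)`, with the spectral parameter `x` specialised to `y`. -/
def opC {N : ℕ} (y : P N) : Module.End (P N) (VN N) :=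
  Matrix.toLin (vBasis N) (vBasis N)
    (Matrix.of fun l m : Word N =>
      monodromy y (fun i => (MvPolynomial.X i : P N)) ((1 : Fin 2), l) ((0 : Fin 2), m))

/-- The Bethe vector `𝔟(η) = C(-t_{i_1}) ⋯ C(-t_{i_k}) v_{(1,…,1)} ∈ 𝕍_N`, where
`i_1 < ⋯ < i_k` are the positions of the letter `0` in `λ`. -/
def betheVec {N : ℕ} (l : Word N) : VN N :=
  (((List.finRange N).filter fun i => l i = 0).map
    fun i => opC (-(MvPolynomial.X i : P N))).prod (vBasis N fun _ => 1)

/-- `∏_{λ_b = 0, λ_a = 1} (t_a - t_b)`, an element of `loc`. -/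
def betheDenom {N : ℕ} (l : Word N) : loc N :=
  ⟨∏ p ∈ Finset.univ.filter (fun p : Fin N × Fin N => l p.1 ≠ 0 ∧ l p.2 = 0),
      (MvPolynomial.X p.1 - MvPolynomial.X p.2), by
    refine Submonoid.prod_mem _ fun p hp => Submonoid.subset_closure ⟨p.1, p.2, ?_, rfl⟩
    rintro h
    simp only [Finset.mem_filter, Finset.mem_univ, true_and] at hp
    exact hp.1 (h ▸ hp.2)⟩

/-- The normalised Bethe vector
`𝔟_λ = ∏_{λ_b = 0, λ_a = 1} (t_a - t_b)⁻¹ 𝔟(η)` in `𝕍_N^loc`. -/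
def normBetheVec {N : ℕ} (l : Word N) : LocalizedModule (loc N) (VN N) :=
  LocalizedModule.mk (betheVec l) (betheDenom l)

/-! ### The geometric side: Grassmannians, fixed points, equivariant cohomology -/

/-- The Grassmannian `X_n = Gr(n, N)` of `n`-dimensional subspaces of `ℂ^N`. -/
abbrev Gr (N n : ℕ) : Type := {W : Submodule ℂ (Fin N → ℂ) // Module.finrank ℂ W = n}

/-- A point of the Grassmannian is fixed by the torus `T` of invertible diagonal matrices. -/
def IsTorusFixed {N n : ℕ} (p : Gr N n) : Prop :=
  ∀ d : Fin N → ℂˣ, p.1.map (Matrix.toLin' (Matrix.diagonal fun i => (d i : ℂ))) = p.1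

/-- The set `X_n^T` of torus fixed points. -/
abbrev FixedPt (N n : ℕ) : Type := {p : Gr N n // IsTorusFixed p}

/-- The coordinate plane `ℂ^λ`, spanned by the `e_i` with `λ_i = 1`. -/
def coordPlane {N : ℕ} (l : Word N) : Submodule ℂ (Fin N → ℂ) :=
  Submodule.span ℂ (Set.range fun i : {i // l i = 1} => (Pi.single i.1 1 : Fin N → ℂ))

theorem sum_word_eq_card {N : ℕ} (l : Word N) :
    ∑ i, (l i : ℕ) = Fintype.card {i // l i = 1} := by
  rw [Fintype.card_subtype, Finset.card_filter]
  refine Finset.sum_congr rfl fun i _ => ?_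
  generalize l i = a
  fin_cases a <;> simp

theorem finrank_coordPlane {N n : ℕ} (l : WordOf N n) :
    Module.finrank ℂ (coordPlane l.1) = n := by
  have h : LinearIndependent ℂ
      (fun i : {i // l.1 i = 1} => (Pi.single i.1 1 : Fin N → ℂ)) := by
    have h0 := (Pi.basisFun ℂ (Fin N)).linearIndependent
    have h1 := h0.comp (fun i : {i // l.1 i = 1} => i.1) Subtype.val_injective
    convert h1 using 1
    funext i
    simp
  rw [coordPlane, finrank_span_eq_card h, ← sum_word_eq_card, l.2]

theorem coordPlane_map_le {N : ℕ} (l : Word N) (d : Fin N → ℂ) :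
    (coordPlane l).map (Matrix.toLin' (Matrix.diagonal d)) ≤ coordPlane l := by
  rw [coordPlane, Submodule.map_span, Submodule.span_le]
  rintro _ ⟨_, ⟨i, rfl⟩, rfl⟩
  have : Matrix.toLin' (Matrix.diagonal d) (Pi.single i.1 1 : Fin N → ℂ)
      = d i.1 • (Pi.single i.1 1 : Fin N → ℂ) := by
    rw [Matrix.toLin'_apply]
    ext k
    rw [Matrix.mulVec_diagonal]
    by_cases h : k = i.1
    · subst h; simp
    · simp [Pi.single_eq_of_ne h]
  rw [this]
  exact Submodule.smul_mem _ _ (Submodule.subset_span ⟨i, rfl⟩)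

theorem isTorusFixed_coordPlane {N n : ℕ} (l : WordOf N n) :
    IsTorusFixed (⟨coordPlane l.1, finrank_coordPlane l⟩ : Gr N n) := by
  intro d
  refine le_antisymm (coordPlane_map_le _ _) fun x hx => ?_
  refine ⟨Matrix.toLin' (Matrix.diagonal fun i => ((d i)⁻¹ : ℂ)) x,
    coordPlane_map_le _ _ ⟨x, hx, rfl⟩, ?_⟩
  rw [Matrix.toLin'_apply, Matrix.toLin'_apply]
  ext k
  rw [Matrix.mulVec_diagonal, Matrix.mulVec_diagonal]
  simp

/-- The torus fixed point `w_λ = ℂ^λ` of `X_n` corresponding to `λ ∈ Λ_n`. -/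
def fixedPt {N n : ℕ} (l : WordOf N n) : FixedPt N n :=
  ⟨⟨coordPlane l.1, finrank_coordPlane l⟩, isTorusFixed_coordPlane l⟩

/-- `H_T^*(X_n)` as a `P`-module, `P = H_T^*(pt)`: restriction to the fixed points identifies it
with the submodule of `H_T^*(X_n^T) = Maps(X_n^T, P)` of all GKM classes, that is, of all `α` with
`α(λ) ≡ α(μ) mod (t_i - t_j)` whenever `μ = s_{ij} λ`. -/
def HT (N n : ℕ) : Submodule (P N) (FixedPt N n → P N) where
  carrier := {α | ∀ (l m : WordOf N n) (i j : Fin N), m.1 = permWord (Equiv.swap i j) l.1 →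
    (MvPolynomial.X i - MvPolynomial.X j : P N) ∣ α (fixedPt l) - α (fixedPt m)}
  zero_mem' := by
    intro l m i j _
    simp
  add_mem' := by
    intro a b ha hb l m i j h
    have := dvd_add (ha l m i j h) (hb l m i j h)
    rwa [← add_sub_add_comm] at this
  smul_mem' := by
    intro c a ha l m i j h
    have := (ha l m i j h).mul_left c
    rwa [mul_sub] at this

/-- The partial order on words: `μ ≥ λ` iff every initial segment of `μ` contains at least as many
letters `1` as that of `λ`. -/
def wordGE {N : ℕ} (m l : Word N) : Prop :=
  ∀ j : Fin N, ∑ i ∈ Finset.Iic j, (l i : ℕ) ≤ ∑ i ∈ Finset.Iic j, (m i : ℕ)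

/-- The twisted order `μ ≥_w λ`, i.e. `w⁻¹ μ ≥ w⁻¹ λ`. -/
def wordGEw {N : ℕ} (w : Equiv.Perm (Fin N)) (m l : Word N) : Prop :=
  wordGE (permWord w⁻¹ m) (permWord w⁻¹ l)

/-- `inv_w(λ) = {(i,j) | w⁻¹(i) < w⁻¹(j), λ_i > λ_j}`. -/
def invSet {N : ℕ} (w : Equiv.Perm (Fin N)) (l : Word N) : Finset (Fin N × Fin N) :=
  Finset.univ.filter fun p => w⁻¹ p.1 < w⁻¹ p.2 ∧ l p.2 < l p.1

/-- The length `ℓ(λ)`: the number of inversions `i < j`, `λ_i > λ_j`. -/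
def wordLength {N : ℕ} (l : Word N) : ℕ := (invSet 1 l).card

/-- The characterising properties of the `w`-twisted Schubert class `S^w_λ ∈ H_T^*(X_n)`. -/
structure IsTwistedSchubertClass {N n : ℕ} (w : Equiv.Perm (Fin N)) (l : WordOf N n)
    (S : HT N n) : Prop where
  /-- `λ` lies in the support. -/
  mem_support : S.1 (fixedPt l) ≠ 0
  /-- The support lies in `{μ | μ ≥_w λ}`. -/
  support_ge : ∀ m : WordOf N n, S.1 (fixedPt m) ≠ 0 → wordGEw w m.1 l.1
  /-- The normalisation at `λ`. -/
  value : S.1 (fixedPt l) =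
    ∏ p ∈ invSet w l.1, (MvPolynomial.X p.1 - MvPolynomial.X p.2 : P N)
  /-- The degree condition. -/
  degree : ∀ m : WordOf N n, wordGEw w m.1 l.1 →
    (S.1 (fixedPt m)).totalDegree = wordLength (permWord w⁻¹ l.1)

/-- `P^loc`. -/
abbrev Ploc (N : ℕ) : Type := Localization (loc N)

/-- `𝕍_N^loc`. -/
abbrev VNloc (N : ℕ) : Type := LocalizedModule (loc N) (VN N)

/-- `H_T^*(X_n)^loc`. -/
abbrev HTloc (N n : ℕ) : Type := LocalizedModule (loc N) (HT N n)

/-- `H_T^*(X_n^T)^loc`, the localisation of `Maps(X_n^T, P)`. -/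
abbrev FuncLoc (N n : ℕ) : Type := LocalizedModule (loc N) (FixedPt N n → P N)

/-- The localised restriction to the fixed points `H_T^*(X_n)^loc → H_T^*(X_n^T)^loc`. -/
def resLoc (N n : ℕ) : HTloc N n →ₗ[Ploc N] FuncLoc N n :=
  LocalizedModule.map (loc N) (HT N n).subtype

open Classical in
/-- The fixed point basis vector `𝟙_p`, `𝟙_p(p') = δ_{p,p'}`. -/
def fixedPtVec {N n : ℕ} (p : FixedPt N n) : FuncLoc N n :=
  LocalizedModule.mk (Pi.single p (1 : P N)) 1

end

end BetheGr

/-!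
Multiplying by `C(y)` one site at a time shows that the coordinate of
`C(y_1) ⋯ C(y_k) v_{(1,…,1)}` along `v_λ` is a Lagrange interpolation formula in the `y_i`, and
that the operators `C` commute. Two consequences carry the theorem.

* For the parameters `-t` and `{y_i} = {t_i | μ_i = 1}`, the coordinate along the complementary
  word `λ̄` satisfies all the defining properties of `S^{ω₀}_λ(μ)`, with a support governed by the
  partial sums of the letters from the right.
* The vectors `C(Y) v_{(1,…,1)}` for `t` and `C(O) v_{(1,…,1)}` for `-t`, where `|Y| + |O| = N`,
  have the pairing `∏ (y + a)`, because the values of the Lagrange basis polynomials with nodes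
  `Y ∪ -O` add up to `1`. For `Y = {-t_i | λ_i = 0}` and `O = {t_i | μ_i = 1}` this product vanishes
  unless `λ = μ`, and it says exactly that `Ψ` maps the Bethe vector of `λ` to a multiple of the
  fixed point vector.

The differences `t_a - t_b` being invertible, `Ψ` is then bijective. A twisted Schubert class is
unique because the difference of two candidates, evaluated at a minimal point of its support, is
divisible by more coprime differences `t_a - t_b` than its degree allows.
-/

namespace BetheGr

/-! ### Recursion of the monodromy matrix in the number of sites -/

section Monodromy

variable {R : Type*} [CommRing R] {N : ℕ}

theorem sum_word_succ {M : Type*} [AddCommMonoid M] (f : Word (N + 1) → M) :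
    ∑ k, f k = ∑ k : Word N, f (Fin.cons 0 k) + ∑ k : Word N, f (Fin.cons 1 k) := by
  rw [← (Fin.consEquiv fun _ : Fin (N + 1) => Fin 2).sum_comp, Fintype.sum_prod_type,
    Fin.sum_univ_two]
  rfl

/-- Extension of a matrix on the sites `1, …, N` by the identity on an additional first site. -/
def siteLift (M : Matrix (Fin 2 × Word N) (Fin 2 × Word N) R) :
    Matrix (Fin 2 × Word (N + 1)) (Fin 2 × Word (N + 1)) R :=
  fun p q => if p.2 0 = q.2 0 then M (p.1, Fin.tail p.2) (q.1, Fin.tail q.2) else 0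

theorem siteLift_cons (M : Matrix (Fin 2 × Word N) (Fin 2 × Word N) R) (a b r s : Fin 2)
    (l m : Word N) :
    siteLift M (a, Fin.cons r l) (b, Fin.cons s m) = if r = s then M (a, l) (b, m) else 0 := by
  simp only [siteLift, Fin.cons_zero, Fin.tail_cons]

theorem siteLift_one : siteLift (1 : Matrix (Fin 2 × Word N) (Fin 2 × Word N) R) = 1 := by
  ext ⟨a, l⟩ ⟨b, m⟩
  induction l using Fin.consCases with | _ r l => ?_
  induction m using Fin.consCases with | _ s m => ?_
  rw [siteLift_cons]
  by_cases h : r = s <;> simp [h, Matrix.one_apply]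

theorem siteLift_mul (M M' : Matrix (Fin 2 × Word N) (Fin 2 × Word N) R) :
    siteLift (M * M') = siteLift M * siteLift M' := by
  ext ⟨a, l⟩ ⟨b, m⟩
  induction l using Fin.consCases with | _ r l => ?_
  induction m using Fin.consCases with | _ s m => ?_
  simp only [siteLift_cons, Matrix.mul_apply, Fintype.sum_prod_type, sum_word_succ]
  fin_cases r <;> fin_cases s <;> simp

/-- `siteLift` as a homomorphism of monoids. -/
def siteLiftHom : Matrix (Fin 2 × Word N) (Fin 2 × Word N) R →*
    Matrix (Fin 2 × Word (N + 1)) (Fin 2 × Word (N + 1)) R where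
  toFun := siteLift
  map_one' := siteLift_one
  map_mul' := siteLift_mul

theorem lax0_succ (j : Fin N) (x t : R) : lax0 j.succ x t = siteLift (lax0 j x t) := by
  ext ⟨a, l⟩ ⟨b, m⟩
  simp only [lax0, siteLift, Fin.forall_fin_succ, Fin.succ_inj, Fin.tail, ne_eq,
    (Fin.succ_ne_zero j).symm, not_false_eq_true, forall_const, ite_and]
  rfl

theorem lax0_zero_cons (x t : R) (a b r s : Fin 2) (l m : Word N) :
    lax0 0 x t (a, Fin.cons r l) (b, Fin.cons s m) =
      if l = m then lax x t (a, r) (b, s) else 0 := by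
  simp only [lax0, Fin.forall_fin_succ, ne_eq, not_true_eq_false, false_implies, true_and,
    Fin.succ_ne_zero, not_false_eq_true, forall_const, Fin.cons_succ, Fin.cons_zero, funext_iff]

theorem monodromy_eq_siteLift_mul (x : R) (t : Fin (N + 1) → R) :
    monodromy x t = siteLift (monodromy x (Fin.tail t)) * lax0 0 x (t 0) := by
  have h : siteLift (monodromy x (Fin.tail t)) = _ := map_list_prod siteLiftHom _
  rw [h, monodromy, List.finRange_succ, List.reverse_cons, List.map_append, List.prod_append,
    List.map_singleton, List.prod_singleton, ← List.map_reverse, List.map_map, List.map_map]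
  exact congrArg (fun L => List.prod L * _)
    (List.map_congr_left fun j _ => lax0_succ j x (t j.succ))

theorem monodromy_succ (x : R) (t : Fin (N + 1) → R) (a b r s : Fin 2) (l m : Word N) :
    monodromy x t (a, Fin.cons r l) (b, Fin.cons s m) =
      ∑ c, monodromy x (Fin.tail t) (a, l) (c, m) * lax x (t 0) (c, r) (b, s) := by
  rw [monodromy_eq_siteLift_mul, Matrix.mul_apply, Fintype.sum_prod_type]
  refine Finset.sum_congr rfl fun c _ => ?_
  simp only [sum_word_succ, siteLift_cons, lax0_zero_cons, mul_ite, mul_zero,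
    Finset.sum_ite_eq', Finset.mem_univ, if_true]
  fin_cases r <;> simp

theorem map_monodromy {S : Type*} [CommRing S] (φ : R →+* S) (x : R) (t : Fin N → R) :
    (monodromy x t).map φ = monodromy (φ x) (φ ∘ t) := by
  have map_lax (x t : R) (p q : Fin 2 × Fin 2) : φ (lax x t p q) = lax (φ x) (φ t) p q := by
    unfold lax
    generalize finProdFinEquiv p = a
    generalize finProdFinEquiv q = b
    fin_cases a <;> fin_cases b <;> simp
  change φ.mapMatrix _ = _
  rw [monodromy, monodromy, map_list_prod, List.map_map]
  refine congrArg List.prod (List.map_congr_left fun j _ => ?_)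
  ext p q
  simp only [Function.comp_apply, RingHom.mapMatrix_apply, Matrix.map_apply, lax0,
    apply_ite φ, map_lax, map_zero]

/-- The block of the monodromy matrix with output `a` and input `b` on the auxiliary factor, acting
on coordinate vectors. -/
def blockAct (a b : Fin 2) (x : R) (t : Fin N → R) : (Word N → R) →ₗ[R] (Word N → R) :=
  Matrix.mulVecLin (Matrix.of fun l m : Word N => monodromy x t (a, l) (b, m))

theorem blockAct_apply (a b : Fin 2) (x : R) (t : Fin N → R) (f : Word N → R) (l : Word N) :
    blockAct a b x t f l = ∑ m, monodromy x t (a, l) (b, m) * f m := rfl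

/-- The coordinates with first letter `s` of a vector on `N + 1` sites. -/
def slice (s : Fin 2) : (Word (N + 1) → R) →ₗ[R] (Word N → R) :=
  LinearMap.funLeft R R fun l => Fin.cons s l

theorem slice_apply (s : Fin 2) (f : Word (N + 1) → R) (l : Word N) :
    slice s f l = f (Fin.cons s l) := rfl

theorem ext_slice {f g : Word (N + 1) → R} (h0 : slice 0 f = slice 0 g)
    (h1 : slice 1 f = slice 1 g) : f = g := by
  ext l
  induction l using Fin.consCases with | _ r l => ?_
  fin_cases r
  · exact congrFun h0 l
  · exact congrFun h1 l

/-- The action of the operator `C(x)` on coordinate vectors. -/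
abbrev actC (x : R) (t : Fin N → R) : (Word N → R) →ₗ[R] (Word N → R) := blockAct 1 0 x t

/-- The action of the operator `D(x)` on coordinate vectors. -/
abbrev actD (x : R) (t : Fin N → R) : (Word N → R) →ₗ[R] (Word N → R) := blockAct 1 1 x t

theorem slice_blockAct (a b s : Fin 2) (x : R) (t : Fin (N + 1) → R) (f : Word (N + 1) → R) :
    slice s (blockAct a b x t f) =
      ∑ c, ∑ r, lax x (t 0) (c, s) (b, r) • blockAct a c x (Fin.tail t) (slice r f) := by
  ext l
  rw [slice_apply, blockAct_apply, sum_word_succ]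
  simp only [monodromy_succ, Pi.add_apply, Pi.smul_apply, blockAct_apply, slice_apply,
    smul_eq_mul, Fin.sum_univ_two, Finset.mul_sum, ← Finset.sum_add_distrib]
  exact Finset.sum_congr rfl fun m _ => by ring

theorem slice_zero_actC (x : R) (t : Fin (N + 1) → R) (f : Word (N + 1) → R) :
    slice 0 (actC x t f) =
      actC x (Fin.tail t) (slice 0 f) + actD x (Fin.tail t) (slice 1 f) := by
  simp [slice_blockAct, Fin.sum_univ_two, lax, finProdFinEquiv]

theorem slice_one_actC (x : R) (t : Fin (N + 1) → R) (f : Word (N + 1) → R) :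
    slice 1 (actC x t f) = (x + t 0) • actC x (Fin.tail t) (slice 1 f) := by
  simp [slice_blockAct, Fin.sum_univ_two, lax, finProdFinEquiv]

theorem slice_zero_actD (x : R) (t : Fin (N + 1) → R) (f : Word (N + 1) → R) :
    slice 0 (actD x t f) = 0 := by
  simp [slice_blockAct, Fin.sum_univ_two, lax, finProdFinEquiv]

theorem slice_one_actD (x : R) (t : Fin (N + 1) → R) (f : Word (N + 1) → R) :
    slice 1 (actD x t f) =
      actC x (Fin.tail t) (slice 0 f) + actD x (Fin.tail t) (slice 1 f) := by
  simp [slice_blockAct, Fin.sum_univ_two, lax, finProdFinEquiv]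

theorem actC_zero_sites (x : R) (t : Fin 0 → R) : actC x t = 0 := by
  ext1 f
  ext l
  simp [blockAct_apply, monodromy]

theorem actD_zero_sites (x : R) (t : Fin 0 → R) : actD x t = LinearMap.id := by
  ext1 f
  ext l
  simp [blockAct_apply, monodromy, Subsingleton.elim _ l]

theorem exchange_relations (x y : R) (t : Fin N → R) (f : Word N → R) :
    actC x t (actC y t f) = actC y t (actC x t f) ∧
    actD x t (actC y t f) = actD y t (actC x t f) ∧
    actC x t (actD y t f) - actC y t (actD x t f) = (x - y) • actD x t (actC y t f) ∧
    actD x t (actD y t f) = actD y t (actD x t f) := by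
  induction N with
  | zero => simp [actC_zero_sites, actD_zero_sites]
  | succ N ih =>
    obtain ⟨cc₀, dc₀, -, -⟩ := ih (Fin.tail t) (slice 0 f)
    obtain ⟨cc₁, dc₁, cd₁, dd₁⟩ := ih (Fin.tail t) (slice 1 f)
    refine ⟨ext_slice ?_ ?_, ext_slice ?_ ?_, ext_slice ?_ ?_, ext_slice ?_ ?_⟩ <;>
      simp only [slice_zero_actC, slice_one_actC, slice_zero_actD, slice_one_actD, map_add,
        map_smul, map_sub, map_zero]
    · linear_combination (norm := module) cc₀ + cd₁ + (x + t 0) • dc₁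
    · linear_combination (norm := module) ((x + t 0) * (y + t 0)) • cc₁
    · linear_combination (norm := module) cc₀ + cd₁ + (x + t 0) • dc₁
    · linear_combination (norm := module) dc₀ + dd₁
    · linear_combination (norm := module) (y + t 0) • cc₀ + (y + t 0) • cd₁
    · linear_combination (norm := module) dc₀ + dd₁

theorem actC_comm (x y : R) (t : Fin N → R) (f : Word N → R) :
    actC x t (actC y t f) = actC y t (actC x t f) :=
  (exchange_relations x y t f).1

end Monodromy

/-! ### Off-shell Bethe vectors -/

section BetheVectors

variable {R : Type*} [CommRing R] {N : ℕ}

/-- The coordinate vector of `v_{(1,…,1)}`. -/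
def vacuum (R : Type*) [CommRing R] (N : ℕ) : Word N → R := Pi.single (fun _ => 1) 1

theorem slice_zero_vacuum : slice 0 (vacuum R (N + 1)) = 0 := by
  ext l
  exact Pi.single_eq_of_ne (fun h => by simpa using congrFun h 0) _

theorem slice_one_vacuum : slice 1 (vacuum R (N + 1)) = vacuum R N := by
  ext l
  have h : (fun _ => 1 : Word (N + 1)) = Fin.cons 1 (fun _ => 1 : Word N) :=
    (Fin.cons_self_tail _).symm
  simp only [slice_apply, vacuum, Pi.single_apply, h, Fin.cons_inj, true_and]

theorem actD_vacuum (x : R) (t : Fin N → R) : actD x t (vacuum R N) = vacuum R N := by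
  induction N with
  | zero => rw [actD_zero_sites, LinearMap.id_apply]
  | succ N ih =>
    apply ext_slice
    · rw [slice_zero_actD, slice_zero_vacuum]
    · rw [slice_one_actD, slice_zero_vacuum, slice_one_vacuum, map_zero, zero_add, ih]

instance leftCommutative_actC (t : Fin N → R) :
    LeftCommutative fun (y : R) (f : Word N → R) => actC y t f :=
  ⟨fun x y f => actC_comm x y t f⟩

/-- The coordinates of the off-shell Bethe vector `C(y_1) ⋯ C(y_k) v_{(1,…,1)}`, a function of the
multiset of the `y_i` since the operators `C(y)` commute. -/
def betheCoords (t : Fin N → R) (Y : Multiset R) : Word N → R :=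
  Y.foldr (fun y f => actC y t f) (vacuum R N)

theorem betheCoords_zero (t : Fin N → R) : betheCoords t 0 = vacuum R N := rfl

theorem betheCoords_cons (t : Fin N → R) (y : R) (Y : Multiset R) :
    betheCoords t (y ::ₘ Y) = actC y t (betheCoords t Y) := Multiset.foldr_cons _ _ _ _

theorem slice_one_betheCoords (t : Fin (N + 1) → R) (Y : Multiset R) :
    slice 1 (betheCoords t Y) = (Y.map (· + t 0)).prod • betheCoords (Fin.tail t) Y := by
  induction Y using Multiset.induction with
  | empty => simp [betheCoords_zero, slice_one_vacuum]
  | cons y Y ih =>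
    rw [betheCoords_cons, slice_one_actC, ih, map_smul, Multiset.map_cons, Multiset.prod_cons,
      mul_smul, betheCoords_cons]

theorem slice_zero_betheCoords_cons (t : Fin (N + 1) → R) (y : R) (Y : Multiset R) :
    slice 0 (betheCoords t (y ::ₘ Y)) = actC y (Fin.tail t) (slice 0 (betheCoords t Y)) +
      (Y.map (· + t 0)).prod • actD y (Fin.tail t) (betheCoords (Fin.tail t) Y) := by
  rw [betheCoords_cons, slice_zero_actC, slice_one_betheCoords, map_smul]

theorem slice_zero_betheCoords_singleton (t : Fin (N + 1) → R) (y : R) :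
    slice 0 (betheCoords t {y}) = vacuum R N := by
  rw [← Multiset.cons_zero, slice_zero_betheCoords_cons, betheCoords_zero, betheCoords_zero,
    slice_zero_vacuum, map_zero, zero_add, actD_vacuum, Multiset.map_zero, Multiset.prod_zero,
    one_smul]

theorem slice_zero_betheCoords_of_add_eq_zero (t : Fin (N + 1) → R) {x : R} (hx : x + t 0 = 0)
    (Y : Multiset R) : slice 0 (betheCoords t (x ::ₘ Y)) = betheCoords (Fin.tail t) Y := by
  induction Y using Multiset.induction with
  | empty => exact slice_zero_betheCoords_singleton t x
  | cons y Y ih =>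
    rw [Multiset.cons_swap, slice_zero_betheCoords_cons, ih, Multiset.map_cons, Multiset.prod_cons,
      hx, zero_mul, zero_smul, add_zero, betheCoords_cons]

theorem slice_one_betheCoords_of_add_eq_zero (t : Fin (N + 1) → R) {x : R} (hx : x + t 0 = 0)
    (Y : Multiset R) : slice 1 (betheCoords t (x ::ₘ Y)) = 0 := by
  rw [slice_one_betheCoords, Multiset.map_cons, Multiset.prod_cons, hx, zero_mul, zero_smul]

theorem sub_smul_slice_zero_betheCoords (t : Fin (N + 1) → R) (x y : R) (Y : Multiset R) :
    (x - y) • slice 0 (betheCoords t (x ::ₘ y ::ₘ Y)) =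
      (x + t 0) • actC x (Fin.tail t) (slice 0 (betheCoords t (y ::ₘ Y))) -
        (y + t 0) • actC y (Fin.tail t) (slice 0 (betheCoords t (x ::ₘ Y))) := by
  simp only [slice_zero_betheCoords_cons, Multiset.map_cons, Multiset.prod_cons, map_add, map_smul]
  rw [betheCoords_cons]
  obtain ⟨cc, -, -, -⟩ := exchange_relations x y (Fin.tail t) (slice 0 (betheCoords t Y))
  obtain ⟨-, -, cd, -⟩ := exchange_relations x y (Fin.tail t) (betheCoords (Fin.tail t) Y)
  generalize (Y.map (· + t 0)).prod = c
  linear_combination (norm := module) -(y + t 0) • cc - ((y + t 0) * c) • cd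

theorem map_betheCoords {S : Type*} [CommRing S] (φ : R →+* S) (t : Fin N → R) (Y : Multiset R)
    (l : Word N) : φ (betheCoords t Y l) = betheCoords (φ ∘ t) (Y.map φ) l := by
  induction Y using Multiset.induction generalizing l with
  | empty =>
    simp only [Multiset.map_zero, betheCoords_zero, vacuum, Pi.single_apply, apply_ite φ, map_one,
      map_zero]
  | cons y Y ih =>
    simp only [Multiset.map_cons, betheCoords_cons, blockAct_apply, map_sum, map_mul, ih,
      ← map_monodromy, Matrix.map_apply]

theorem sub_dvd_betheCoords_sub (t : Fin N → R) (x y : R) (Y : Multiset R) (l : Word N) :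
    x - y ∣ betheCoords t (x ::ₘ Y) l - betheCoords t (y ::ₘ Y) l := by
  rw [← Ideal.mem_span_singleton, ← Ideal.Quotient.eq, map_betheCoords, map_betheCoords,
    Multiset.map_cons, Multiset.map_cons,
    Ideal.Quotient.eq.2 (Ideal.mem_span_singleton_self (x - y))]

end BetheVectors

section Interpolation

variable {ι K : Type*} [DecidableEq ι] [Field K] {N : ℕ}

theorem map_val_eq_cons_erase {α : Type*} {s : Finset ι} {j : ι} (hj : j ∈ s) (y : ι → α) :
    s.val.map y = y j ::ₘ (s.erase j).val.map y := by
  rw [← Multiset.map_cons, Finset.erase_val, Multiset.cons_erase hj]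

theorem eval_lagrange_basis (s : Finset ι) (y : ι → K) (j : ι) (x : K) :
    (Lagrange.basis s y j).eval x = ∏ i ∈ s.erase j, (x - y i) / (y j - y i) := by
  simp only [Lagrange.basis, Lagrange.basisDivisor, Polynomial.eval_prod, Polynomial.eval_mul,
    Polynomial.eval_C, Polynomial.eval_sub, Polynomial.eval_X, div_eq_inv_mul]

theorem sub_mul_eval_lagrange_basis_erase {s : Finset ι} {y : ι → K} (hy : Set.InjOn y s)
    {i j : ι} (hi : i ∈ s) (hj : j ∈ s.erase i) (x : K) :
    (x - y i) * (Lagrange.basis (s.erase i) y j).eval x =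
      (y j - y i) * (Lagrange.basis s y j).eval x := by
  have hji : y j - y i ≠ 0 := sub_ne_zero.2 fun h =>
    Finset.ne_of_mem_erase hj (hy (Finset.mem_of_mem_erase hj) hi h)
  rw [eval_lagrange_basis, eval_lagrange_basis, Finset.erase_right_comm,
    ← Finset.mul_prod_erase (s.erase j) _
      (Finset.mem_erase.2 ⟨(Finset.ne_of_mem_erase hj).symm, hi⟩)]
  field_simp

theorem slice_zero_betheCoords_eq_sum_lagrange (t : Fin (N + 1) → K) (s : Finset ι) (y : ι → K)
    (hy : Set.InjOn y s) :
    slice 0 (betheCoords t (s.val.map y)) =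
      ∑ j ∈ s, (Lagrange.basis s y j).eval (-t 0) •
        betheCoords (Fin.tail t) ((s.erase j).val.map y) := by
  induction s using Finset.strongInduction with | _ s ih => ?_
  obtain rfl | hne := s.eq_empty_or_nonempty
  · simp [betheCoords_zero, slice_zero_vacuum]
  obtain ⟨a, rfl⟩ | hs := hne.exists_eq_singleton_or_nontrivial
  · simp [betheCoords_zero, slice_zero_betheCoords_singleton]
  have actC_slice (i : ι) (hi : i ∈ s) :
      (y i + t 0) • actC (y i) (Fin.tail t)
          (slice 0 (betheCoords t ((s.erase i).val.map y))) =
        ∑ j ∈ s, ((y i - y j) * (Lagrange.basis s y j).eval (-t 0)) •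
          betheCoords (Fin.tail t) ((s.erase j).val.map y) := by
    rw [ih _ (Finset.erase_ssubset hi) (hy.mono (by simp)), map_sum, Finset.smul_sum,
      ← Finset.add_sum_erase s _ hi, sub_self, zero_mul, zero_smul, zero_add]
    refine Finset.sum_congr rfl fun j hj => ?_
    have hij : i ∈ s.erase j := Finset.mem_erase.2 ⟨(Finset.ne_of_mem_erase hj).symm, hi⟩
    rw [map_smul, smul_smul, map_val_eq_cons_erase hij, betheCoords_cons, Finset.erase_right_comm]
    congr 1
    linear_combination -sub_mul_eval_lagrange_basis_erase hy hi hj (-t 0)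
  obtain ⟨i, hi, k, hk, hik⟩ := hs
  have hki : k ∈ s.erase i := Finset.mem_erase.2 ⟨hik.symm, hk⟩
  have hik' : i ∈ s.erase k := Finset.mem_erase.2 ⟨hik, hi⟩
  have exchange := sub_smul_slice_zero_betheCoords t (y i) (y k) (((s.erase i).erase k).val.map y)
  rw [← map_val_eq_cons_erase hki, Finset.erase_right_comm, ← map_val_eq_cons_erase hik',
    ← map_val_eq_cons_erase hi, actC_slice i hi, actC_slice k hk, ← Finset.sum_sub_distrib]
    at exchange
  refine smul_right_injective _ (sub_ne_zero.2 fun h => hik (hy hi hk h)) (exchange.trans ?_)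
  dsimp only
  rw [Finset.smul_sum]
  exact Finset.sum_congr rfl fun j _ => by module

end Interpolation

/-! ### The pairing of Bethe vectors -/

section Pairing

variable {R : Type*} [CommRing R] {ι κ : Type*} {N : ℕ}

/-- The complementary word `λ̄`. -/
def complWord (l : Word N) : Word N := fun i => 1 - l i

theorem complWord_cons (s : Fin 2) (l : Word N) :
    complWord (Fin.cons s l : Word (N + 1)) = Fin.cons (1 - s) (complWord l) := by
  ext i
  refine Fin.cases ?_ (fun j => ?_) i <;> simp [complWord]

/-- The bilinear form on coordinate vectors for which `v_λ` is dual to `v_λ̄`. -/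
def complPairing (R : Type*) [CommRing R] (N : ℕ) :
    (Word N → R) →ₗ[R] (Word N → R) →ₗ[R] R :=
  (dotProductBilin R R).compl₂ (LinearMap.funLeft R R complWord)

theorem complPairing_apply (f g : Word N → R) :
    complPairing R N f g = ∑ l, f l * g (complWord l) := rfl

theorem complPairing_succ (f g : Word (N + 1) → R) :
    complPairing R (N + 1) f g =
      complPairing R N (slice 0 f) (slice 1 g) + complPairing R N (slice 1 f) (slice 0 g) := by
  simp only [complPairing_apply, sum_word_succ, complWord_cons, slice_apply]
  rfl

section Lagrange

variable {K : Type*} [Field K] {s : Finset ι} {s' : Finset κ} {y : ι → K} {a : κ → K}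

theorem eval_lagrange_basis_disjSum_inl [DecidableEq ι] [DecidableEq κ] {j : ι} (hj : j ∈ s)
    (hya : ∀ i ∈ s, ∀ k ∈ s', y i + a k ≠ 0) (x : K) :
    (Lagrange.basis (s.disjSum s') (Sum.elim y (-a)) (.inl j)).eval (-x) *
        ∏ i ∈ s, ∏ k ∈ s', (y i + a k) =
      (Lagrange.basis s y j).eval (-x) * ((∏ k ∈ s', (a k - x)) *
        ∏ i ∈ s.erase j, ∏ k ∈ s', (y i + a k)) := by
  have herase : (s.disjSum s').erase (.inl j) = (s.erase j).disjSum s' := by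
    ext (i | k) <;> simp
  have hne : ∏ k ∈ s', (y j + a k) ≠ 0 := Finset.prod_ne_zero_iff.2 (hya j hj)
  rw [eval_lagrange_basis, eval_lagrange_basis, herase, Finset.prod_disjSum,
    ← Finset.mul_prod_erase s _ hj]
  simp only [Sum.elim_inl, Sum.elim_inr, Pi.neg_apply, sub_neg_eq_add, neg_add_eq_sub,
    Finset.prod_div_distrib (s := s')]
  field_simp

theorem eval_lagrange_basis_disjSum_inr [DecidableEq ι] [DecidableEq κ] {j : κ} (hj : j ∈ s')
    (hya : ∀ i ∈ s, ∀ k ∈ s', y i + a k ≠ 0) (x : K) :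
    (Lagrange.basis (s.disjSum s') (Sum.elim y (-a)) (.inr j)).eval (-x) *
        ∏ i ∈ s, ∏ k ∈ s', (y i + a k) =
      (Lagrange.basis s' a j).eval x * ((∏ i ∈ s, (y i + x)) *
        ∏ i ∈ s, ∏ k ∈ s'.erase j, (y i + a k)) := by
  have herase : (s.disjSum s').erase (.inr j) = s.disjSum (s'.erase j) := by
    ext (i | k) <;> simp
  have hne : ∏ i ∈ s, (y i + a j) ≠ 0 := Finset.prod_ne_zero_iff.2 fun i hi => hya i hi j hj
  simp only [eval_lagrange_basis, herase, Finset.prod_disjSum, Sum.elim_inl, Sum.elim_inr,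
    Pi.neg_apply, sub_neg_eq_add, ← Finset.mul_prod_erase s' _ hj, Finset.prod_mul_distrib]
  have hs (i : ι) : (-x - y i) / (-a j - y i) = (y i + x) / (y i + a j) := by
    rw [← neg_div_neg_eq]; ring
  have hs' (k : κ) : (-x + a k) / (-a j + a k) = (x - a k) / (a j - a k) := by
    rw [← neg_div_neg_eq]; ring
  simp only [hs, hs', Finset.prod_div_distrib (s := s)]
  field_simp

theorem sum_eval_lagrange_basis_disjSum [DecidableEq ι] [DecidableEq κ] (hy : Set.InjOn y s)
    (ha : Set.InjOn a s') (hya : ∀ i ∈ s, ∀ k ∈ s', y i + a k ≠ 0) (hcard : s.card + s'.card ≠ 0)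
    (x : K) :
    ∑ j ∈ s, (Lagrange.basis (s.disjSum s') (Sum.elim y (-a)) (.inl j)).eval x +
      ∑ j ∈ s', (Lagrange.basis (s.disjSum s') (Sum.elim y (-a)) (.inr j)).eval x = 1 := by
  have nodes_injOn : Set.InjOn (Sum.elim y (-a)) (s.disjSum s') := by
    rintro (i | k) hi (j | l) hj h <;>
      simp only [Finset.mem_coe, Finset.inl_mem_disjSum, Finset.inr_mem_disjSum] at hi hj
    · exact congrArg _ (hy hi hj h)
    · exact absurd (eq_neg_iff_add_eq_zero.1 h) (hya i hi l hj)
    · exact absurd (eq_neg_iff_add_eq_zero.1 h.symm) (hya j hj k hi)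
    · exact congrArg _ (ha hi hj (neg_injective h))
  have nodes_nonempty : (s.disjSum s').Nonempty :=
    Finset.card_pos.1 (by rw [Finset.card_disjSum]; omega)
  rw [← Finset.sum_disjSum s s' fun j => (Lagrange.basis _ _ j).eval x,
    ← Polynomial.eval_finsetSum, Lagrange.sum_basis nodes_injOn nodes_nonempty,
    Polynomial.eval_one]

/-- The two terms of `complPairing_succ` are the two halves of `∑ L_j = 1`, where `L_j` are the
Lagrange basis polynomials with nodes `y i` and `-a k`. -/
theorem complPairing_betheCoords_of_injOn (t : Fin N → K) (hy : Set.InjOn y s)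
    (ha : Set.InjOn a s') (hya : ∀ i ∈ s, ∀ k ∈ s', y i + a k ≠ 0)
    (hcard : s.card + s'.card = N) :
    complPairing K N (betheCoords t (s.val.map y)) (betheCoords (-t) (s'.val.map a)) =
      ∏ i ∈ s, ∏ k ∈ s', (y i + a k) := by
  classical
  induction N generalizing s s' with
  | zero =>
    obtain ⟨rfl, rfl⟩ : s = ∅ ∧ s' = ∅ := by simpa using hcard
    simp [complPairing_apply, betheCoords_zero, vacuum, Subsingleton.elim _ (fun _ => 1 : Word 0)]
  | succ N ih =>
    have sum_basis := sum_eval_lagrange_basis_disjSum hy ha hya (by omega) (-t 0)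
    have htail : Fin.tail (-t) = -Fin.tail t := rfl
    rw [complPairing_succ, slice_zero_betheCoords_eq_sum_lagrange t s y hy,
      slice_zero_betheCoords_eq_sum_lagrange (-t) s' a ha, slice_one_betheCoords,
      slice_one_betheCoords, htail, ← one_mul (∏ i ∈ s, ∏ k ∈ s', (y i + a k)), ← sum_basis,
      add_mul, Finset.sum_mul, Finset.sum_mul]
    simp only [map_sum, map_smul, LinearMap.sum_apply, LinearMap.smul_apply, smul_eq_mul,
      Finset.mul_sum, Multiset.map_map, Function.comp_apply, Pi.neg_apply, neg_neg,
      ← sub_eq_add_neg, Finset.prod_map_val]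
    refine congrArg₂ _ (Finset.sum_congr rfl fun j hj => ?_) (Finset.sum_congr rfl fun j hj => ?_)
    · rw [eval_lagrange_basis_disjSum_inl hj hya, ih _ (hy.mono (by simp)) ha
        (fun i hi => hya i (Finset.mem_of_mem_erase hi))
        (by have := Finset.card_erase_add_one hj; omega)]
      ring
    · rw [eval_lagrange_basis_disjSum_inr hj hya, ih _ hy (ha.mono (by simp))
        (fun i hi k hk => hya i hi k (Finset.mem_of_mem_erase hk))
        (by have := Finset.card_erase_add_one hj; omega)]

end Lagrange

theorem map_complPairing {S : Type*} [CommRing S] (φ : R →+* S) (f g : Word N → R) :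
    φ (complPairing R N f g) = complPairing S N (φ ∘ f) (φ ∘ g) := by
  simp only [complPairing_apply, map_sum, map_mul, Function.comp_apply]

theorem map_complPairing_betheCoords {S : Type*} [CommRing S] (φ : R →+* S) (t : Fin N → R)
    (Y O : Multiset R) :
    φ (complPairing R N (betheCoords t Y) (betheCoords (-t) O)) =
      complPairing S N (betheCoords (φ ∘ t) (Y.map φ)) (betheCoords (-(φ ∘ t)) (O.map φ)) := by
  have hneg : φ ∘ (-t) = -(φ ∘ t) := funext fun i => map_neg φ (t i)
  rw [map_complPairing]
  congr 1 <;> [congr 1; skip] <;> ext l <;> simp only [Function.comp_apply, map_betheCoords, hneg]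

theorem complPairing_betheCoords (t : Fin N → R) (s : Finset ι) (s' : Finset κ) (y : ι → R)
    (a : κ → R) (hcard : s.card + s'.card = N) :
    complPairing R N (betheCoords t (s.val.map y)) (betheCoords (-t) (s'.val.map a)) =
      ∏ i ∈ s, ∏ k ∈ s', (y i + a k) := by
  classical
  -- It suffices to treat indeterminates `t`, `y`, `a`, hence elements of a field.
  let A := MvPolynomial (Fin N ⊕ ι ⊕ κ) ℤ
  let T : Fin N → A := fun i => .X (.inl i)
  let Y : ι → A := fun i => .X (.inr (.inl i))
  let O : κ → A := fun k => .X (.inr (.inr k))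
  have universal :
      complPairing A N (betheCoords T (s.val.map Y)) (betheCoords (-T) (s'.val.map O)) =
        ∏ i ∈ s, ∏ k ∈ s', (Y i + O k) := by
    let φ := algebraMap A (FractionRing A)
    have φ_injective : Function.Injective φ := IsFractionRing.injective A _
    have X_injective : Function.Injective fun i => φ (.X i) :=
      φ_injective.comp (MvPolynomial.X_injective (R := ℤ))
    apply φ_injective
    rw [map_complPairing_betheCoords, Multiset.map_map, Multiset.map_map,
      complPairing_betheCoords_of_injOn _ _ _ _ hcard]
    · simp only [map_prod, map_add, Function.comp_apply]
    · exact (X_injective.comp (Sum.inr_injective.comp Sum.inl_injective)).injOn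
    · exact (X_injective.comp (Sum.inr_injective.comp Sum.inr_injective)).injOn
    · intro i _ k _ h
      have h0 : Y i + O k = 0 := φ_injective (by simpa using h)
      simpa [Y, O] using congrArg (MvPolynomial.eval (Pi.single (Sum.inr (Sum.inl i)) 1)) h0
  have specialised := congrArg (MvPolynomial.aeval (Sum.elim t (Sum.elim y a))).toRingHom universal
  rw [map_complPairing_betheCoords, Multiset.map_map, Multiset.map_map] at specialised
  simpa [T, Y, O, Function.comp_def] using specialised

end Pairing

/-! ### Combinatorics of words -/

section Words

variable {N : ℕ}

/-- The number of letters `1` of a word at the positions `≥ k`. The order `≥_{ω₀}` compares words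
through these numbers. -/
def suffixSum (k : ℕ) (l : Word N) : ℕ := ∑ i : Fin N with k ≤ i.val, (l i).val

theorem suffixSum_eq_sum_ite (k : ℕ) (l : Word N) :
    suffixSum k l = ∑ i : Fin N, if k ≤ i.val then (l i).val else 0 :=
  Finset.sum_filter _ _

theorem suffixSum_zero_cons (s : Fin 2) (l : Word N) :
    suffixSum 0 (Fin.cons s l : Word (N + 1)) = s + suffixSum 0 l := by
  simp [suffixSum, Fin.sum_univ_succ]

theorem suffixSum_succ_cons (k : ℕ) (s : Fin 2) (l : Word N) :
    suffixSum (k + 1) (Fin.cons s l : Word (N + 1)) = suffixSum k l := by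
  simp [suffixSum_eq_sum_ite, Fin.sum_univ_succ]

theorem suffixSum_eq_zero_of_le {k : ℕ} (hk : N ≤ k) (l : Word N) : suffixSum k l = 0 :=
  Finset.sum_eq_zero fun i hi => by
    have := (Finset.mem_filter.1 hi).2
    omega

theorem suffixSum_antitone (l : Word N) : Antitone fun k => suffixSum k l := fun _ _ h =>
  Finset.sum_le_sum_of_subset (Finset.monotone_filter_right _ fun _ _ hi => h.trans hi)

theorem suffixSum_update {l : Word N} {b : Fin N} (hb : l b = 1) (k : ℕ) :
    suffixSum k (Function.update l b 0) + (if k ≤ b.val then 1 else 0) = suffixSum k l := by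
  simp only [suffixSum_eq_sum_ite]
  rw [← Finset.sum_erase_add _ _ (Finset.mem_univ b),
    ← Finset.sum_erase_add _ (fun i : Fin N => if k ≤ i.val then (l i).val else 0)
      (Finset.mem_univ b),
    Finset.sum_congr rfl fun i hi => by
    rw [Function.update_of_ne (Finset.ne_of_mem_erase hi)]]
  simp [hb]

theorem suffixSum_eq_of_forall_lt {m : Word N} {k : ℕ} (h : ∀ i : Fin N, i.val < k → m i = 0) :
    suffixSum k m = suffixSum 0 m :=
  Finset.sum_subset (Finset.monotone_filter_right _ fun _ _ _ => Nat.zero_le _) fun i _ hi => by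
    simp [h i (by simpa using hi)]

theorem eq_of_forall_suffixSum_eq {l m : Word N} (h : ∀ k, suffixSum k l = suffixSum k m) :
    l = m := by
  induction N with
  | zero => exact Subsingleton.elim _ _
  | succ N ih =>
    induction l using Fin.consCases with | _ r l => ?_
    induction m using Fin.consCases with | _ s m => ?_
    obtain rfl : l = m := ih fun k => by simpa only [suffixSum_succ_cons] using h (k + 1)
    have h0 := h 0
    rw [suffixSum_zero_cons, suffixSum_zero_cons, Nat.add_right_cancel_iff] at h0
    rw [Fin.ext h0]

/-- The order `μ ≥_{ω₀} λ`: every final segment of `μ` contains at least as many letters `1` as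
that of `λ`. -/
def SuffixGE (m l : Word N) : Prop := ∀ k, suffixSum k l ≤ suffixSum k m

theorem suffixGE_cons_self_iff (s : Fin 2) {m l : Word N} :
    SuffixGE (Fin.cons s m : Word (N + 1)) (Fin.cons s l : Word (N + 1)) ↔ SuffixGE m l := by
  refine ⟨fun h k => by simpa only [suffixSum_succ_cons] using h (k + 1), fun h => ?_⟩
  rintro (_ | k)
  · simpa only [suffixSum_zero_cons] using Nat.add_le_add_left (h 0) _
  · simpa only [suffixSum_succ_cons] using h k

theorem suffixGE_zero_one_of_update {m l : Word N} {b : Fin N} (hb : m b = 1)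
    (h : SuffixGE (Function.update m b 0) l) :
    SuffixGE (Fin.cons 0 m : Word (N + 1)) (Fin.cons 1 l : Word (N + 1)) := by
  rintro (_ | k)
  · rw [suffixSum_zero_cons, suffixSum_zero_cons, ← suffixSum_update hb 0]
    simpa [add_comm 1, Nat.lt_succ_iff] using h 0
  · rw [suffixSum_succ_cons, suffixSum_succ_cons, ← suffixSum_update hb k]
    exact (h k).trans (Nat.le_add_right _ _)

theorem exists_update_suffixGE {m l : Word N}
    (h : SuffixGE (Fin.cons 0 m : Word (N + 1)) (Fin.cons 1 l : Word (N + 1))) :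
    ∃ b, m b = 1 ∧ SuffixGE (Function.update m b 0) l := by
  have h0 : suffixSum 0 l < suffixSum 0 m := by
    simpa only [suffixSum_zero_cons, Fin.val_one, Fin.val_zero, zero_add,
      Nat.one_add_le_iff] using h 0
  have hone : {i | m i = 1}.Nonempty := by
    by_contra! hempty
    refine h0.not_ge (le_of_eq_of_le (Finset.sum_eq_zero fun i _ => ?_) (Nat.zero_le _))
    have : m i ≠ 1 := fun hi => hempty.subset hi
    omega
  -- the first letter `1` of `m` can be dropped
  obtain ⟨b, hb⟩ := exists_minimal_of_wellFoundedLT _ hone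
  refine ⟨b, hb.prop, fun k => ?_⟩
  have hu := suffixSum_update hb.prop k
  split_ifs at hu with hkb
  · have hm : suffixSum k m = suffixSum 0 m := suffixSum_eq_of_forall_lt fun i hik => by
      have : m i ≠ 1 := fun hi => by
        have := hb.le_of_le hi (by rw [Fin.le_def]; omega)
        rw [Fin.le_def] at this
        omega
      omega
    have hl : suffixSum k l ≤ suffixSum 0 l := suffixSum_antitone l (Nat.zero_le k)
    omega
  · have hk := h (k + 1)
    rw [suffixSum_succ_cons, suffixSum_succ_cons] at hk
    omega

/-- The number of letters `0` of a word. -/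
def zeroCount (l : Word N) : ℕ := Finset.card {i | l i = 0}

theorem zeroCount_eq_sum_ite (l : Word N) : zeroCount l = ∑ i, if l i = 0 then 1 else 0 :=
  Finset.card_filter _ _

theorem zeroCount_cons_zero (l : Word N) :
    zeroCount (Fin.cons 0 l : Word (N + 1)) = zeroCount l + 1 := by
  simp [zeroCount_eq_sum_ite, Fin.sum_univ_succ, add_comm, -Finset.sum_boole]

theorem zeroCount_cons_one (l : Word N) :
    zeroCount (Fin.cons 1 l : Word (N + 1)) = zeroCount l := by
  simp [zeroCount_eq_sum_ite, Fin.sum_univ_succ, -Finset.sum_boole]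

theorem zeroCount_add_card (l : Word N) : zeroCount l + Finset.card {i | l i = 1} = N := by
  have h := Finset.card_filter_add_card_filter_not (s := Finset.univ) fun i => l i = 0
  rw [Finset.card_univ, Fintype.card_fin] at h
  rwa [zeroCount, Finset.filter_congr fun i _ => show l i = 1 ↔ ¬l i = 0 by omega]

theorem suffixSum_zero_eq_card (l : Word N) : suffixSum 0 l = Finset.card {i | l i = 1} := by
  rw [suffixSum_eq_sum_ite, Finset.card_filter]
  refine Finset.sum_congr rfl fun i _ => ?_
  generalize l i = a
  fin_cases a <;> rfl

theorem zeroCount_add_suffixSum (l : Word N) : zeroCount l + suffixSum 0 l = N := by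
  rw [suffixSum_zero_eq_card, zeroCount_add_card]

theorem card_invSet_eq_sum (w : Equiv.Perm (Fin N)) (l : Word N) :
    (invSet w l).card = ∑ i, ∑ j, if w⁻¹ i < w⁻¹ j ∧ l j < l i then 1 else 0 := by
  rw [invSet, Finset.card_filter, ← Finset.univ_product_univ, Finset.sum_product]

theorem wordLength_eq_sum (l : Word N) :
    wordLength l = ∑ i, ∑ j, if i < j ∧ l j < l i then 1 else 0 :=
  card_invSet_eq_sum 1 l

theorem wordLength_cons_zero (l : Word N) :
    wordLength (Fin.cons 0 l : Word (N + 1)) = wordLength l := by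
  simp [wordLength_eq_sum, Fin.sum_univ_succ, -Finset.sum_boole]

theorem wordLength_cons_one (l : Word N) :
    wordLength (Fin.cons 1 l : Word (N + 1)) = wordLength l + zeroCount l := by
  have h : ∀ a : Fin 2, ¬ (1 < a) := by decide
  have h' : ∀ a : Fin 2, a < 1 ↔ a = 0 := by decide
  simp only [wordLength_eq_sum, Fin.sum_univ_succ, zeroCount_eq_sum_ite, Fin.cons_zero,
    Fin.cons_succ]
  simp [h, h', add_comm]

theorem wordLength_complWord (l : Word N) :
    wordLength (complWord l) = (invSet Fin.revPerm l).card := by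
  have h : ∀ a b : Fin 2, 1 - a < 1 - b ↔ b < a := by decide
  rw [wordLength_eq_sum, card_invSet_eq_sum, Finset.sum_comm]
  simp only [complWord, h, Equiv.Perm.inv_def, Fin.revPerm_symm, Fin.revPerm_apply, Fin.rev_lt_rev]

theorem wordLength_permWord_inv (w : Equiv.Perm (Fin N)) (l : Word N) :
    wordLength (permWord w⁻¹ l) = (invSet w l).card := by
  rw [wordLength_eq_sum, card_invSet_eq_sum, ← Equiv.sum_comp w⁻¹]
  refine Finset.sum_congr rfl fun i _ => ?_
  rw [← Equiv.sum_comp w⁻¹]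
  simp [permWord, -Finset.sum_boole]

/-- The `r`-th letter `1` from the right, at position `p`, is followed by `N - 1 - p - (r - 1)`
letters `0`; summing over all letters `1` gives the identity. -/
theorem wordLength_add_sum_suffixSum (l : Word N) :
    wordLength l + ∑ k : Fin N, suffixSum k l + (suffixSum 0 l).choose 2 = suffixSum 0 l * N := by
  induction N with
  | zero => simp [wordLength_eq_sum, suffixSum]
  | succ N ih =>
    induction l using Fin.consCases with | _ s l => ?_
    have ih := ih l
    have hz := zeroCount_add_suffixSum l
    rw [Fin.sum_univ_succ]
    simp only [Fin.val_zero, Fin.val_succ, suffixSum_succ_cons, suffixSum_zero_cons]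
    fin_cases s
    · simp only [Fin.zero_eta, wordLength_cons_zero, zero_add]
      linarith
    · simp only [Fin.mk_one, wordLength_cons_one, add_comm 1 (suffixSum 0 l),
        Nat.choose_succ_succ' _ 1, Nat.choose_one_right, add_mul, mul_add]
      linarith

theorem wordLength_lt_of_suffixGE {m l : Word N} (h : SuffixGE m l)
    (h0 : suffixSum 0 m = suffixSum 0 l) (hne : m ≠ l) : wordLength m < wordLength l := by
  have hlt : ∑ k : Fin N, suffixSum k l < ∑ k : Fin N, suffixSum k m := by
    refine (Finset.sum_le_sum fun (k : Fin N) _ => h k).lt_of_ne fun heq => hne ?_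
    rw [Finset.sum_eq_sum_iff_of_le fun (k : Fin N) _ => h k] at heq
    refine eq_of_forall_suffixSum_eq fun k => ?_
    rcases lt_or_ge k N with hk | hk
    · exact (heq ⟨k, hk⟩ (Finset.mem_univ _)).symm
    · rw [suffixSum_eq_zero_of_le hk, suffixSum_eq_zero_of_le hk]
  have hm := wordLength_add_sum_suffixSum m
  have hl := wordLength_add_sum_suffixSum l
  rw [h0] at hm
  omega

theorem suffixSum_zero_permWord (w : Equiv.Perm (Fin N)) (l : Word N) :
    suffixSum 0 (permWord w l) = suffixSum 0 l := by
  simpa [suffixSum, permWord] using Equiv.sum_comp w⁻¹ fun i => (l i).val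

theorem suffixSum_zero_wordOf {n : ℕ} (l : WordOf N n) : suffixSum 0 l.1 = n := by
  simpa [suffixSum] using l.2

theorem permWord_swap_of_eq {l : Word N} {i j : Fin N} (h : l i = l j) :
    permWord (Equiv.swap i j) l = l := by
  ext k
  simp only [permWord, Equiv.swap_inv, Equiv.swap_apply_def]
  split_ifs <;> simp_all

theorem update_permWord_swap {l : Word N} {i j : Fin N} (hj : l j = 0) :
    Function.update (permWord (Equiv.swap i j) l) j 0 = Function.update l i 0 := by
  ext k
  simp only [Function.update_apply, permWord, Equiv.swap_inv, Equiv.swap_apply_def]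
  split_ifs <;> simp_all

theorem suffixGE_permWord_swap {l : Word N} {i j : Fin N} (hij : i < j) (hi : l i = 1)
    (hj : l j = 0) : SuffixGE (permWord (Equiv.swap i j) l) l := fun k => by
  have hj' : permWord (Equiv.swap i j) l j = 1 := by simp [permWord, hi]
  rw [← suffixSum_update hj', update_permWord_swap hj, ← suffixSum_update hi]
  have : i.val < j.val := hij
  split_ifs <;> omega

theorem wordLength_permWord_swap_lt {l : Word N} {i j : Fin N} (hij : i < j) (h : l j < l i) :
    wordLength (permWord (Equiv.swap i j) l) < wordLength l := by
  have hi : l i = 1 := by omega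
  have hj : l j = 0 := by omega
  refine wordLength_lt_of_suffixGE (suffixGE_permWord_swap hij hi hj)
    (suffixSum_zero_permWord _ _) fun heq => ?_
  have := congrFun heq j
  simp [permWord, hi, hj] at this

theorem sum_Iic_add_suffixSum (l : Word N) (j : Fin N) :
    ∑ i ∈ Finset.Iic j, (l i).val + suffixSum (j + 1) l = suffixSum 0 l := by
  have h : (Finset.univ.filter fun i : Fin N => ¬j.val + 1 ≤ i.val) = Finset.Iic j := by
    ext i
    rw [Finset.mem_filter_univ, Finset.mem_Iic, Fin.le_def]
    omega
  rw [← h, suffixSum, suffixSum, Finset.sum_filter_not_add_sum_filter]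
  simp

theorem suffixGE_of_wordGE {m l : Word N} (h : wordGE m l)
    (h0 : suffixSum 0 m = suffixSum 0 l) : SuffixGE l m := by
  rintro (_ | k)
  · exact h0.le
  rcases lt_or_ge k N with hk | hk
  · have hl := sum_Iic_add_suffixSum l ⟨k, hk⟩
    have hm := sum_Iic_add_suffixSum m ⟨k, hk⟩
    have := h ⟨k, hk⟩
    simp only at hl hm
    omega
  · rw [suffixSum_eq_zero_of_le (hk.trans k.le_succ)]
    exact Nat.zero_le _

theorem sum_Iic_permWord_revPerm (l : Word N) (j : Fin N) :
    ∑ i ∈ Finset.Iic j, (permWord Fin.revPerm⁻¹ l i).val = suffixSum j.rev l := by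
  have h : (Finset.univ.filter fun i : Fin N => j.rev.val ≤ i.val) =
      (Finset.Iic j).map Fin.revPerm.toEmbedding := by
    ext i
    simp only [Fin.val_rev, Finset.mem_filter, Finset.mem_univ, true_and, Finset.mem_map_equiv,
      Fin.revPerm_symm, Fin.revPerm_apply, Finset.mem_Iic, Fin.le_def]
    omega
  rw [suffixSum, h, Finset.sum_map]
  simp [permWord]

theorem wordGEw_revPerm_iff {m l : Word N} : wordGEw Fin.revPerm m l ↔ SuffixGE m l := by
  simp only [wordGEw, wordGE, sum_Iic_permWord_revPerm]
  refine ⟨fun h k => ?_, fun h j => h _⟩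
  rcases lt_or_ge k N with hk | hk
  · simpa using h (Fin.rev ⟨k, hk⟩)
  · rw [suffixSum_eq_zero_of_le hk]
    exact Nat.zero_le _

end Words

/-! ### Values of the Schubert classes at the fixed points -/

section Schubert

variable {R : Type*} {N : ℕ}

/-- The multiset of the `t_i` with `λ_i = a`. -/
def letterVals (t : Fin N → R) (l : Word N) (a : Fin 2) : Multiset R :=
  (Finset.univ.filter fun i => l i = a).val.map t

theorem letterVals_cons_self (t : Fin (N + 1) → R) (l : Word N) (a : Fin 2) :
    letterVals t (Fin.cons a l : Word (N + 1)) a = t 0 ::ₘ letterVals (Fin.tail t) l a := by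
  simp only [letterVals, Fin.univ_succ, Finset.filter_cons, Finset.filter_map, Fin.cons_zero,
    if_true, Finset.cons_val, Finset.map_val, Multiset.map_cons, Multiset.map_map]
  rfl

theorem letterVals_cons_of_ne (t : Fin (N + 1) → R) (l : Word N) {s a : Fin 2} (h : s ≠ a) :
    letterVals t (Fin.cons s l : Word (N + 1)) a = letterVals (Fin.tail t) l a := by
  simp only [letterVals, Fin.univ_succ, Finset.filter_cons, Finset.filter_map, Fin.cons_zero, h,
    if_false, Finset.map_val, Multiset.map_map]
  rfl

theorem map_letterVals {S : Type*} (φ : R → S) (t : Fin N → R) (l : Word N) (a : Fin 2) :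
    (letterVals t l a).map φ = letterVals (φ ∘ t) l a :=
  Multiset.map_map _ _ _

theorem erase_filter_eq_one (l : Word N) (b : Fin N) :
    (Finset.univ.filter fun i => l i = 1).erase b =
      Finset.univ.filter fun i => Function.update l b 0 i = 1 := by
  ext i
  by_cases h : i = b <;> simp [h]

theorem letterVals_eq_cons (t : Fin N → R) {l : Word N} {b : Fin N} (hb : l b = 1) :
    letterVals t l 1 = t b ::ₘ letterVals t (Function.update l b 0) 1 := by
  rw [letterVals, map_val_eq_cons_erase (j := b) (by simpa using hb), erase_filter_eq_one,
    letterVals]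

variable [CommRing R]

/-- The value at the fixed point `w_μ` of the Schubert class `S^{ω₀}_λ`. -/
def schubertValue (t : Fin N → R) (l m : Word N) : R :=
  betheCoords (-t) (letterVals t m 1) (complWord l)

theorem map_schubertValue {S : Type*} [CommRing S] (φ : R →+* S) (t : Fin N → R) (l m : Word N) :
    φ (schubertValue t l m) = schubertValue (φ ∘ t) l m := by
  have hneg : φ ∘ (-t) = -(φ ∘ t) := funext fun i => map_neg φ (t i)
  rw [schubertValue, map_betheCoords, map_letterVals, hneg, schubertValue]

theorem schubertValue_cons_zero_zero (t : Fin (N + 1) → R) (l m : Word N) :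
    schubertValue t (Fin.cons 0 l : Word (N + 1)) (Fin.cons 0 m : Word (N + 1)) =
      (∏ i with m i = 1, (t i.succ - t 0)) * schubertValue (Fin.tail t) l m := by
  rw [schubertValue, complWord_cons, letterVals_cons_of_ne _ _ (by decide), sub_zero,
    ← slice_apply _ (betheCoords (-t) _), slice_one_betheCoords, letterVals, Multiset.map_map]
  simp only [Pi.neg_apply, ← sub_eq_add_neg]
  rfl

theorem schubertValue_cons_one_one (t : Fin (N + 1) → R) (l m : Word N) :
    schubertValue t (Fin.cons 1 l : Word (N + 1)) (Fin.cons 1 m : Word (N + 1)) =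
      schubertValue (Fin.tail t) l m := by
  rw [schubertValue, complWord_cons, letterVals_cons_self, sub_self,
    ← slice_apply _ (betheCoords (-t) _),
    slice_zero_betheCoords_of_add_eq_zero _ (add_neg_cancel _)]
  rfl

theorem schubertValue_cons_zero_one (t : Fin (N + 1) → R) (l m : Word N) :
    schubertValue t (Fin.cons 0 l : Word (N + 1)) (Fin.cons 1 m : Word (N + 1)) = 0 := by
  rw [schubertValue, complWord_cons, letterVals_cons_self, sub_zero,
    ← slice_apply _ (betheCoords (-t) _),
    slice_one_betheCoords_of_add_eq_zero _ (add_neg_cancel _)]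
  rfl

theorem schubertValue_cons_one_zero (t : Fin (N + 1) → R) (l m : Word N) :
    schubertValue t (Fin.cons 1 l : Word (N + 1)) (Fin.cons 0 m : Word (N + 1)) =
      slice 0 (betheCoords (-t) (letterVals (Fin.tail t) m 1)) (complWord l) := by
  rw [schubertValue, complWord_cons, letterVals_cons_of_ne _ _ (by decide)]
  rfl

theorem suffixGE_of_schubertValue_ne_zero_of_injective {K : Type*} [Field K] {t : Fin N → K}
    (ht : Function.Injective t) {l m : Word N} (h : schubertValue t l m ≠ 0) : SuffixGE m l := by
  induction N with
  | zero => exact fun k => by simp [suffixSum]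
  | succ N ih =>
    have ht' : Function.Injective (Fin.tail t) := ht.comp (Fin.succ_injective N)
    induction l using Fin.consCases with | _ r l => ?_
    induction m using Fin.consCases with | _ s m => ?_
    obtain rfl | rfl : r = 0 ∨ r = 1 := by omega
    all_goals obtain rfl | rfl : s = 0 ∨ s = 1 := by omega
    · rw [schubertValue_cons_zero_zero] at h
      exact (suffixGE_cons_self_iff 0).2 (ih ht' (right_ne_zero_of_mul h))
    · exact absurd (schubertValue_cons_zero_one _ _ _) h
    · rw [schubertValue_cons_one_zero, letterVals,
        slice_zero_betheCoords_eq_sum_lagrange _ _ _ ht'.injOn, Finset.sum_apply] at h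
      obtain ⟨b, hb, hne⟩ := Finset.exists_ne_zero_of_sum_ne_zero h
      have hb1 : m b = 1 := by simpa using hb
      rw [erase_filter_eq_one] at hne
      exact suffixGE_zero_one_of_update hb1 (ih ht' (right_ne_zero_of_mul hne))
    · rw [schubertValue_cons_one_one] at h
      exact (suffixGE_cons_self_iff 1).2 (ih ht' h)

theorem suffixGE_of_schubertValue_ne_zero {t : Fin N → R} {l m : Word N}
    (h : schubertValue t l m ≠ 0) : SuffixGE m l := by
  -- It suffices to treat indeterminates `t`, hence distinct elements of a field.
  let T : Fin N → MvPolynomial (Fin N) ℤ := MvPolynomial.X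
  let ψ := algebraMap (MvPolynomial (Fin N) ℤ) (FractionRing (MvPolynomial (Fin N) ℤ))
  have hψ : Function.Injective ψ := IsFractionRing.injective _ _
  refine suffixGE_of_schubertValue_ne_zero_of_injective (t := ψ ∘ T)
    (hψ.comp (MvPolynomial.X_injective)) ?_
  rw [← map_schubertValue, map_ne_zero_iff ψ hψ]
  intro h0
  have hT : (MvPolynomial.aeval t : MvPolynomial (Fin N) ℤ →ₐ[ℤ] R).toRingHom ∘ T = t :=
    funext fun i => MvPolynomial.aeval_X t i
  exact h (by rw [← hT, ← map_schubertValue, h0, map_zero])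

theorem schubertValue_self (t : Fin N → R) (l : Word N) :
    schubertValue t l l = ∏ p ∈ invSet Fin.revPerm l, (t p.1 - t p.2) := by
  suffices schubertValue t l l = ∏ i, ∏ j, if j < i ∧ l j < l i then t i - t j else 1 by
    rw [this, invSet, Finset.prod_filter, ← Finset.univ_product_univ, Finset.prod_product]
    simp only [Equiv.Perm.inv_def, Fin.revPerm_symm, Fin.revPerm_apply, Fin.rev_lt_rev]
  induction N with
  | zero =>
    simp [schubertValue, letterVals, betheCoords_zero, vacuum,
      Subsingleton.elim _ (fun _ => 1 : Word 0)]
  | succ N ih =>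
    have h : ∀ a : Fin 2, ¬ (1 < a) := by decide
    have h' : ∀ a : Fin 2, 0 < a ↔ a = 1 := by decide
    induction l using Fin.consCases with | _ r l => ?_
    simp only [Fin.prod_univ_succ, Fin.cons_zero, Fin.cons_succ]
    obtain rfl | rfl : r = 0 ∨ r = 1 := by omega
    · rw [schubertValue_cons_zero_zero, ih, Finset.prod_filter, ← Finset.prod_mul_distrib]
      simp [h', Fin.tail]
    · rw [schubertValue_cons_one_one, ih]
      simp [h, Fin.tail]

theorem sub_dvd_schubertValue_sub_of_ne (t : Fin N → R) (l : Word N) {m : Word N} {i j : Fin N}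
    (hi : m i = 1) (hj : m j = 0) :
    t i - t j ∣ schubertValue t l m - schubertValue t l (permWord (Equiv.swap i j) m) := by
  have hj' : permWord (Equiv.swap i j) m j = 1 := by simp [permWord, hi]
  rw [schubertValue, schubertValue, letterVals_eq_cons t hi, letterVals_eq_cons t hj',
    update_permWord_swap hj]
  exact sub_dvd_betheCoords_sub _ _ _ _ _

theorem sub_dvd_schubertValue_sub (t : Fin N → R) (l m : Word N) (i j : Fin N) :
    t i - t j ∣ schubertValue t l m - schubertValue t l (permWord (Equiv.swap i j) m) := by
  rcases (by omega : m i = m j ∨ m i = 1 ∧ m j = 0 ∨ m j = 1 ∧ m i = 0) with h | ⟨h1, h2⟩ | ⟨h1, h2⟩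
  · rw [permWord_swap_of_eq h, sub_self]
    exact dvd_zero _
  · exact sub_dvd_schubertValue_sub_of_ne t l h1 h2
  · rw [← neg_dvd, neg_sub, Equiv.swap_comm]
    exact sub_dvd_schubertValue_sub_of_ne t l h1 h2

theorem complPairing_betheCoords_letterVals (t : Fin N → R) {l m : Word N}
    (hlm : zeroCount l = zeroCount m) :
    complPairing R N (betheCoords t (letterVals (-t) l 0)) (betheCoords (-t) (letterVals t m 1)) =
      ∏ j with l j = 0, ∏ i with m i = 1, (t i - t j) := by
  have hcard : zeroCount l + Finset.card {i | m i = 1} = N := hlm ▸ zeroCount_add_card m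
  rw [letterVals, letterVals, complPairing_betheCoords _ _ _ _ _ hcard]
  simp only [Pi.neg_apply, neg_add_eq_sub]

end Schubert

/-! ### Degrees and supports of the Schubert classes -/

section Degree

open MvPolynomial

variable {σ A : Type*} [CommRing A] {k c : ℕ} {N : ℕ}

/-- A coordinate vector of weight `k` whose coordinate at `λ` is homogeneous of degree `ℓ(λ) + c`.
These gradings are compatible with the operators `C(x)` and `D(x)`. -/
structure IsGraded (k c : ℕ) (f : Word N → MvPolynomial σ A) : Prop where
  isHomogeneous (l : Word N) : (f l).IsHomogeneous (wordLength l + c)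
  zeroCount_eq (l : Word N) : f l ≠ 0 → zeroCount l = k

theorem isGraded_zero : IsGraded k c (0 : Word N → MvPolynomial σ A) :=
  ⟨fun _ => isHomogeneous_zero _ _ _, fun _ h => absurd rfl h⟩

theorem IsGraded.add {f g : Word N → MvPolynomial σ A} (hf : IsGraded k c f)
    (hg : IsGraded k c g) : IsGraded k c (f + g) where
  isHomogeneous l := (hf.isHomogeneous l).add (hg.isHomogeneous l)
  zeroCount_eq l h := by
    by_cases h0 : f l = 0
    · exact hg.zeroCount_eq l fun h1 => h (by rw [Pi.add_apply, h0, h1, add_zero])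
    · exact hf.zeroCount_eq l h0

theorem IsGraded.smul {f : Word N → MvPolynomial σ A} (hf : IsGraded k c f)
    {x : MvPolynomial σ A} (hx : x.IsHomogeneous 1) : IsGraded k (c + 1) (x • f) where
  isHomogeneous l := by
    rw [← add_assoc, add_comm _ 1]
    exact hx.mul (hf.isHomogeneous l)
  zeroCount_eq l h := hf.zeroCount_eq l (right_ne_zero_of_mul h)

theorem isGraded_iff_slice {f : Word (N + 1) → MvPolynomial σ A} :
    IsGraded k c f ↔ (∀ l, (slice 0 f l).IsHomogeneous (wordLength l + c)) ∧
      (∀ l, slice 0 f l ≠ 0 → zeroCount l + 1 = k) ∧ IsGraded k (c + k) (slice 1 f) := by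
  have homogeneous_iff (h : ∀ l, slice 1 f l ≠ 0 → zeroCount l = k) (l : Word N) :
      (slice 1 f l).IsHomogeneous (wordLength l + zeroCount l + c) ↔
        (slice 1 f l).IsHomogeneous (wordLength l + (c + k)) := by
    by_cases h0 : slice 1 f l = 0
    · simp [h0, isHomogeneous_zero]
    · rw [h l h0, add_assoc, add_comm k]
  refine ⟨fun ⟨hdeg, hwt⟩ => ?_, fun ⟨hdeg₀, hwt₀, hdeg₁, hwt₁⟩ => ⟨fun l => ?_, fun l => ?_⟩⟩
  · have hwt₁ (l : Word N) (h : slice 1 f l ≠ 0) : zeroCount l = k :=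
      (zeroCount_cons_one l).symm.trans (hwt _ h)
    exact ⟨fun l => wordLength_cons_zero l ▸ hdeg (Fin.cons 0 l),
      fun l h => (zeroCount_cons_zero l).symm.trans (hwt _ h),
      fun l => (homogeneous_iff hwt₁ l).1 (wordLength_cons_one l ▸ hdeg (Fin.cons 1 l)), hwt₁⟩
  all_goals
    induction l using Fin.consCases with | _ s l => ?_
    obtain rfl | rfl : s = 0 ∨ s = 1 := by omega
  · exact (wordLength_cons_zero l).symm ▸ hdeg₀ l
  · exact (wordLength_cons_one l).symm ▸ (homogeneous_iff hwt₁ l).2 (hdeg₁ l)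
  · exact fun h => (zeroCount_cons_zero l).trans (hwt₀ l h)
  · exact fun h => (zeroCount_cons_one l).trans (hwt₁ l h)

theorem isGraded_zero_iff {f : Word (N + 1) → MvPolynomial σ A} :
    IsGraded 0 c f ↔ slice 0 f = 0 ∧ IsGraded 0 c (slice 1 f) := by
  rw [isGraded_iff_slice, add_zero]
  refine ⟨fun ⟨_, h, h₁⟩ => ⟨funext fun l => by_contra fun h0 => Nat.succ_ne_zero _ (h l h0), h₁⟩,
    fun ⟨h, h₁⟩ => ⟨fun l => ?_, fun l => ?_, h₁⟩⟩ <;> rw [h]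
  · exact isHomogeneous_zero _ _ _
  · exact fun h0 => absurd rfl h0

theorem isGraded_succ_iff {f : Word (N + 1) → MvPolynomial σ A} :
    IsGraded (k + 1) c f ↔
      IsGraded k c (slice 0 f) ∧ IsGraded (k + 1) (c + (k + 1)) (slice 1 f) := by
  rw [isGraded_iff_slice, ← and_assoc]
  simp only [Nat.add_right_cancel_iff]
  exact and_congr_left fun _ => ⟨fun ⟨h, h'⟩ => ⟨h, h'⟩, fun ⟨h, h'⟩ => ⟨h, h'⟩⟩

theorem IsGraded.actC_and_actD {x : MvPolynomial σ A} (hx : x.IsHomogeneous 1)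
    {t : Fin N → MvPolynomial σ A} (ht : ∀ i, (t i).IsHomogeneous 1)
    (f : Word N → MvPolynomial σ A) :
    (IsGraded k c f → IsGraded (k + 1) c (actC x t f)) ∧
      (IsGraded k (c + k) f → IsGraded k c (actD x t f)) := by
  induction N generalizing k c with
  | zero =>
    rw [actC_zero_sites, actD_zero_sites, LinearMap.id_apply]
    refine ⟨fun _ => isGraded_zero, fun h => ⟨fun l => ?_, h.zeroCount_eq⟩⟩
    by_cases h0 : f l = 0
    · rw [h0]
      exact isHomogeneous_zero _ _ _
    · obtain rfl : 0 = k := h.zeroCount_eq l h0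
      exact h.isHomogeneous l
  | succ N ih =>
    have ih {k c} (f) := ih (k := k) (c := c) (t := Fin.tail t) (fun i => ht i.succ) f
    have sum_graded {c : ℕ} (h : IsGraded k c f) :
        IsGraded k c (actC x (Fin.tail t) (slice 0 f) + actD x (Fin.tail t) (slice 1 f)) := by
      obtain _ | k := k
      · obtain ⟨h₀, h₁⟩ := isGraded_zero_iff.1 h
        rw [h₀, map_zero, zero_add]
        exact (ih _).2 h₁
      · obtain ⟨h₀, h₁⟩ := isGraded_succ_iff.1 h
        exact ((ih _).1 h₀).add ((ih _).2 h₁)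
    refine ⟨fun h => isGraded_succ_iff.2 ⟨?_, ?_⟩, fun h => isGraded_iff_slice.2 ⟨?_, ?_, ?_⟩⟩
    · rw [slice_zero_actC]
      exact sum_graded h
    · rw [slice_one_actC, ← add_assoc]
      exact ((ih _).1 (isGraded_iff_slice.1 h).2.2).smul (hx.add (ht 0))
    · rw [slice_zero_actD]
      exact fun _ => isHomogeneous_zero _ _ _
    · rw [slice_zero_actD]
      exact fun _ h => absurd rfl h
    · rw [slice_one_actD]
      exact sum_graded h

theorem isGraded_vacuum : IsGraded 0 0 (vacuum (MvPolynomial σ A) N) := by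
  induction N with
  | zero =>
    refine ⟨fun l => ?_, fun l _ => by simp [zeroCount]⟩
    simpa [vacuum, wordLength_eq_sum, Subsingleton.elim l fun _ => 1] using isHomogeneous_one σ A
  | succ N ih => exact isGraded_zero_iff.2 ⟨slice_zero_vacuum, by rwa [slice_one_vacuum]⟩

theorem isGraded_betheCoords {t : Fin N → MvPolynomial σ A} (ht : ∀ i, (t i).IsHomogeneous 1)
    {Y : Multiset (MvPolynomial σ A)} (hY : ∀ y ∈ Y, y.IsHomogeneous 1) :
    IsGraded Y.card 0 (betheCoords t Y) := by
  induction Y using Multiset.induction with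
  | empty => exact isGraded_vacuum
  | cons y Y ih =>
    rw [betheCoords_cons, Multiset.card_cons]
    exact (IsGraded.actC_and_actD (hY y (Multiset.mem_cons_self y Y)) ht _).1
      (ih fun z hz => hY z (Multiset.mem_cons_of_mem hz))

theorem isHomogeneous_schubertValue (l m : Word N) :
    (schubertValue (X : Fin N → MvPolynomial (Fin N) A) l m).IsHomogeneous
      (wordLength (complWord l)) := by
  have isHomogeneous_neg_X (i : Fin N) :
      ((-X : Fin N → MvPolynomial (Fin N) A) i).IsHomogeneous 1 := (isHomogeneous_X A i).neg
  refine (isGraded_betheCoords isHomogeneous_neg_X fun y hy => ?_).isHomogeneous _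
  obtain ⟨i, -, rfl⟩ := Multiset.mem_map.1 hy
  exact isHomogeneous_X A i

theorem exists_schubertValue_ne_zero (K : Type*) [CommRing K] [IsDomain K] [Infinite K]
    {l m : Word N} (h : SuffixGE m l) (hlm : suffixSum 0 l = suffixSum 0 m) :
    ∃ t : Fin N → K, schubertValue t l m ≠ 0 := by
  induction N with
  | zero =>
    simp [schubertValue, letterVals, betheCoords_zero, vacuum,
      Subsingleton.elim _ (fun _ => 1 : Word 0)]
  | succ N ih =>
    induction l using Fin.consCases with | _ r l => ?_
    induction m using Fin.consCases with | _ s m => ?_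
    rw [suffixSum_zero_cons, suffixSum_zero_cons] at hlm
    obtain rfl | rfl : r = 0 ∨ r = 1 := by omega
    all_goals obtain rfl | rfl : s = 0 ∨ s = 1 := by omega
    · obtain ⟨t, ht⟩ := ih ((suffixGE_cons_self_iff 0).1 h) (by simpa using hlm)
      obtain ⟨t₀, ht₀⟩ := (Set.finite_range t).exists_notMem
      refine ⟨Fin.cons t₀ t, ?_⟩
      rw [schubertValue_cons_zero_zero]
      refine mul_ne_zero (Finset.prod_ne_zero_iff.2 fun i _ => ?_) ht
      exact sub_ne_zero.2 fun hi => ht₀ ⟨i, hi⟩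
    · have h1 := h 1
      simp only [suffixSum_succ_cons, Fin.val_zero, Fin.val_one] at h1 hlm
      omega
    · obtain ⟨b, hb, hge⟩ := exists_update_suffixGE h
      obtain ⟨t, ht⟩ := ih hge (by
        have := suffixSum_update hb 0
        simp only [Fin.val_zero, Fin.val_one, zero_le, if_true] at this hlm
        omega)
      refine ⟨Fin.cons (t b) t, ?_⟩
      rw [schubertValue_cons_one_zero, letterVals_eq_cons _ hb,
        slice_zero_betheCoords_of_add_eq_zero _ (by simp)]
      exact ht
    · obtain ⟨t, ht⟩ := ih ((suffixGE_cons_self_iff 1).1 h) (by simpa using hlm)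
      refine ⟨Fin.cons 0 t, ?_⟩
      rwa [schubertValue_cons_one_one]

theorem schubertValue_X_ne_zero [IsDomain A] [Infinite A] {l m : Word N} (h : SuffixGE m l)
    (hlm : suffixSum 0 l = suffixSum 0 m) :
    schubertValue (X : Fin N → MvPolynomial (Fin N) A) l m ≠ 0 := by
  obtain ⟨t, ht⟩ := exists_schubertValue_ne_zero A h hlm
  intro h0
  have hX : (aeval t : MvPolynomial (Fin N) A →ₐ[A] A).toRingHom ∘ X = t :=
    funext fun i => aeval_X t i
  exact ht (by rw [← hX, ← map_schubertValue, h0, map_zero])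

end Degree

/-! ### Torus fixed points -/

section FixedPoints

variable {N n : ℕ}

theorem mem_coordPlane_iff (l : Word N) (x : Fin N → ℂ) :
    x ∈ coordPlane l ↔ ∀ i, l i ≠ 1 → x i = 0 := by
  refine ⟨fun hx i hi => ?_, fun h => ?_⟩
  · suffices coordPlane l ≤ LinearMap.ker (LinearMap.proj i : (Fin N → ℂ) →ₗ[ℂ] ℂ) from this hx
    rw [coordPlane, Submodule.span_le]
    rintro _ ⟨k, rfl⟩
    exact Pi.single_eq_of_ne (fun h : i = k.1 => hi (h ▸ k.2)) 1
  · rw [← (Pi.basisFun ℂ (Fin N)).sum_repr x]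
    refine Submodule.sum_mem _ fun i _ => ?_
    rw [Pi.basisFun_repr, Pi.basisFun_apply]
    by_cases hi : l i = 1
    · exact Submodule.smul_mem _ _ (Submodule.subset_span ⟨⟨i, hi⟩, rfl⟩)
    · rw [h i hi, zero_smul]
      exact Submodule.zero_mem _

theorem single_mem_coordPlane_iff (l : Word N) (i : Fin N) :
    (Pi.single i 1 : Fin N → ℂ) ∈ coordPlane l ↔ l i = 1 := by
  rw [mem_coordPlane_iff]
  refine ⟨fun h => by_contra fun hi => ?_, fun h j hj => ?_⟩
  · simpa using h i hi
  · exact Pi.single_eq_of_ne (fun hji : j = i => hj (hji ▸ h)) 1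

theorem fixedPt_injective : Function.Injective (fixedPt : WordOf N n → FixedPt N n) := by
  intro l m h
  have h' : coordPlane l.1 = coordPlane m.1 := congrArg (fun p => p.1.1) h
  ext i
  have := single_mem_coordPlane_iff l.1 i
  rw [h', single_mem_coordPlane_iff] at this
  omega

theorem IsTorusFixed.single_mem {p : Gr N n} (hp : IsTorusFixed p) {x : Fin N → ℂ} (hx : x ∈ p.1)
    {i : Fin N} (hi : x i ≠ 0) : (Pi.single i 1 : Fin N → ℂ) ∈ p.1 := by
  -- Doubling the `i`-th coordinate changes `x` by `x i • e_i`.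
  let d : Fin N → ℂˣ := Function.update 1 i (Units.mk0 2 two_ne_zero)
  have hdx : Matrix.toLin' (Matrix.diagonal fun k => (d k : ℂ)) x ∈ p.1 := by
    have := Submodule.mem_map_of_mem (f := Matrix.toLin' (Matrix.diagonal fun k => (d k : ℂ))) hx
    rwa [hp d] at this
  convert p.1.smul_mem (x i)⁻¹ (p.1.sub_mem hdx hx) using 1
  ext k
  rw [Pi.smul_apply, Pi.sub_apply, Matrix.toLin'_apply, Matrix.mulVec_diagonal]
  obtain rfl | hk := eq_or_ne k i
  · simp only [d, Pi.single_eq_same, Function.update_self, Units.val_mk0, smul_eq_mul]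
    field_simp
    ring
  · simp [d, hk]

theorem fixedPt_surjective : Function.Surjective (fixedPt : WordOf N n → FixedPt N n) := by
  classical
  rintro ⟨p, hp⟩
  let l : Word N := fun i => if (Pi.single i 1 : Fin N → ℂ) ∈ p.1 then 1 else 0
  have hl (i : Fin N) : l i = 1 ↔ (Pi.single i 1 : Fin N → ℂ) ∈ p.1 := by simp [l]
  have coordPlane_eq : coordPlane l = p.1 := by
    refine le_antisymm ?_ fun x hx => (mem_coordPlane_iff l x).2 fun i hi => ?_
    · rw [coordPlane, Submodule.span_le]
      rintro _ ⟨i, rfl⟩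
      exact (hl i).1 i.2
    · exact by_contra fun hxi => hi ((hl i).2 (hp.single_mem hx hxi))
  have hn : ∑ i, (l i : ℕ) = n := by
    rw [← finrank_coordPlane (n := ∑ i, (l i : ℕ)) ⟨l, rfl⟩, coordPlane_eq, p.2]
  exact ⟨⟨l, hn⟩, Subtype.ext (Subtype.ext coordPlane_eq)⟩

/-- The torus fixed points of `Gr(n, N)`, indexed by the words with `n` letters `1`. -/
noncomputable def fixedPtEquiv (N n : ℕ) : WordOf N n ≃ FixedPt N n :=
  Equiv.ofBijective fixedPt ⟨fixedPt_injective, fixedPt_surjective⟩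

theorem fixedPtEquiv_symm_fixedPt (l : WordOf N n) : (fixedPtEquiv N n).symm (fixedPt l) = l :=
  (fixedPtEquiv N n).symm_apply_apply l

noncomputable instance : Fintype (FixedPt N n) := Fintype.ofEquiv _ (fixedPtEquiv N n)

end FixedPoints

/-! ### Existence and uniqueness of the twisted Schubert classes -/

section Classes

open MvPolynomial

variable {N n : ℕ}

/-- The twisted Schubert class `S^{ω₀}_λ`, given by its restrictions to the fixed points. -/
noncomputable def schubertClass (l : WordOf N n) : HT N n :=
  ⟨fun p => schubertValue X l.1 ((fixedPtEquiv N n).symm p).1, by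
    intro m m' i j h
    beta_reduce
    rw [fixedPtEquiv_symm_fixedPt, fixedPtEquiv_symm_fixedPt, h]
    exact sub_dvd_schubertValue_sub X l.1 m.1 i j⟩

theorem schubertClass_fixedPt (l m : WordOf N n) :
    (schubertClass l).1 (fixedPt m) = schubertValue X l.1 m.1 := by
  change schubertValue X l.1 ((fixedPtEquiv N n).symm (fixedPt m)).1 = _
  rw [fixedPtEquiv_symm_fixedPt]

theorem suffixSum_zero_eq_suffixSum_zero (l m : WordOf N n) :
    suffixSum 0 l.1 = suffixSum 0 m.1 := by
  rw [suffixSum_zero_wordOf, suffixSum_zero_wordOf]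

theorem isTwistedSchubertClass_schubertClass (l : WordOf N n) :
    IsTwistedSchubertClass Fin.revPerm l (schubertClass l) where
  mem_support := by
    rw [schubertClass_fixedPt]
    exact schubertValue_X_ne_zero (fun _ => le_rfl) rfl
  support_ge m hm := by
    rw [schubertClass_fixedPt] at hm
    exact wordGEw_revPerm_iff.2 (suffixGE_of_schubertValue_ne_zero hm)
  value := by rw [schubertClass_fixedPt, schubertValue_self]
  degree m hm := by
    rw [schubertClass_fixedPt, wordLength_permWord_inv, ← wordLength_complWord]
    exact (isHomogeneous_schubertValue l.1 m.1).totalDegree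
      (schubertValue_X_ne_zero (wordGEw_revPerm_iff.1 hm) (suffixSum_zero_eq_suffixSum_zero l m))

theorem X_sub_X_ne_zero {σ A : Type*} [CommRing A] [Nontrivial A] {i j : σ} (h : i ≠ j) :
    (X i - X j : MvPolynomial σ A) ≠ 0 :=
  sub_ne_zero.2 fun h' => h (X_injective h')

theorem irreducible_X_sub_X {σ A : Type*} [CommRing A] [IsDomain A] {i j : σ} (h : i ≠ j) :
    Irreducible (X i - X j : MvPolynomial σ A) := by
  classical
  refine irreducible_of_totalDegree_eq_one
    (((isHomogeneous_X A i).sub (isHomogeneous_X A j)).totalDegree (X_sub_X_ne_zero h))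
    fun x hx => isUnit_of_dvd_one ?_
  have := hx (Finsupp.single i 1)
  rwa [coeff_sub, coeff_X, coeff_X, if_pos rfl,
    if_neg fun h' => h.symm ((Finsupp.single_left_inj one_ne_zero).1 h'), sub_zero] at this

theorem isRelPrime_X_sub_X {σ A : Type*} [CommRing A] [IsDomain A] {i j k l : σ} (hij : i ≠ j)
    (hkl : k ≠ l) (h : s(i, j) ≠ s(k, l)) :
    IsRelPrime (X i - X j : MvPolynomial σ A) (X k - X l) := by
  classical
  rw [(irreducible_X_sub_X hij).isRelPrime_iff_not_dvd]
  rintro ⟨q, hq⟩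
  -- Setting `t_i = t_j` kills the left factor only.
  have := congrArg (aeval (Function.update (X : σ → MvPolynomial σ A) i (X j))) hq
  simp only [map_mul, map_sub, aeval_X, Function.update_self, Function.update_of_ne hij.symm,
    sub_self, zero_mul, sub_eq_zero, Function.update_apply] at this
  rw [Ne, Sym2.eq_iff] at h
  split_ifs at this with hk hl hl
  · exact hkl (hk.trans hl.symm)
  · exact h (Or.inl ⟨hk.symm, X_injective this⟩)
  · exact h (Or.inr ⟨hl.symm, (X_injective this).symm⟩)
  · exact hkl (X_injective this)

theorem prod_invSet_dvd {w : Equiv.Perm (Fin N)} {D : HT N n} {m : WordOf N n}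
    (h : ∀ m' : WordOf N n, wordLength (permWord w⁻¹ m'.1) < wordLength (permWord w⁻¹ m.1) →
      D.1 (fixedPt m') = 0) :
    ∏ p ∈ invSet w m.1, (X p.1 - X p.2 : P N) ∣ D.1 (fixedPt m) := by
  have lt_of_mem {p} (hp : p ∈ invSet w m.1) : w⁻¹ p.1 < w⁻¹ p.2 ∧ m.1 p.2 < m.1 p.1 := by
    simpa [invSet] using hp
  have ne_of_mem {p} (hp : p ∈ invSet w m.1) : p.1 ≠ p.2 :=
    fun h => (lt_of_mem hp).1.ne (congrArg _ h)
  refine Finset.prod_dvd_of_isRelPrime (fun p hp q hq hpq => ?_) fun p hp => ?_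
  · refine isRelPrime_X_sub_X (ne_of_mem hp) (ne_of_mem hq) fun h => ?_
    obtain h | ⟨h₁, h₂⟩ := Sym2.eq_iff.1 h
    · exact hpq (Prod.ext h.1 h.2)
    · exact (lt_of_mem hp).1.not_gt (h₁ ▸ h₂ ▸ (lt_of_mem hq).1)
  · let m' : WordOf N n := ⟨permWord (Equiv.swap p.1 p.2) m.1,
      (Equiv.sum_comp (Equiv.swap p.1 p.2)⁻¹ fun i => (m.1 i : ℕ)).trans m.2⟩
    have permWord_m' : permWord w⁻¹ m'.1 =
        permWord (Equiv.swap (w⁻¹ p.1) (w⁻¹ p.2)) (permWord w⁻¹ m.1) := by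
      ext k
      simp [m', permWord, Equiv.swap_apply_apply, Equiv.Perm.mul_apply]
    have hm' := h m' (permWord_m' ▸ wordLength_permWord_swap_lt (lt_of_mem hp).1
      (by simpa [permWord] using (lt_of_mem hp).2))
    simpa [hm'] using D.2 m m' p.1 p.2 rfl

theorem eq_zero_of_totalDegree_lt {w : Equiv.Perm (Fin N)} {D : HT N n}
    (h : ∀ m : WordOf N n, D.1 (fixedPt m) ≠ 0 →
      (D.1 (fixedPt m)).totalDegree < wordLength (permWord w⁻¹ m.1)) : D = 0 := by
  suffices ∀ m : WordOf N n, D.1 (fixedPt m) = 0 from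
    Subtype.ext (funext (fixedPt_surjective.forall.2 this))
  by_contra! hD
  obtain ⟨m, hm, hmin⟩ := exists_minimalFor_of_wellFoundedLT
    (fun m : WordOf N n => D.1 (fixedPt m) ≠ 0) (fun m => wordLength (permWord w⁻¹ m.1)) hD
  have hdvd : ∏ p ∈ invSet w m.1, (X p.1 - X p.2 : P N) ∣ D.1 (fixedPt m) :=
    prod_invSet_dvd fun m' hlt => by_contra fun h0 => hlt.not_ge (hmin h0 hlt.le)
  have hdeg : (∏ p ∈ invSet w m.1, (X p.1 - X p.2 : P N)).totalDegree = (invSet w m.1).card := by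
    refine IsHomogeneous.totalDegree ?_ (ne_zero_of_dvd_ne_zero hm hdvd)
    rw [Finset.card_eq_sum_ones]
    exact IsHomogeneous.prod _ _ _ fun p _ => (isHomogeneous_X _ _).sub (isHomogeneous_X _ _)
  refine (h m hm).not_ge ?_
  rw [wordLength_permWord_inv, ← hdeg]
  exact totalDegree_le_of_dvd_of_isDomain hdvd hm

theorem IsTwistedSchubertClass.totalDegree_sub_lt {w : Equiv.Perm (Fin N)} {l : WordOf N n}
    {S S' : HT N n} (h : IsTwistedSchubertClass w l S) (h' : IsTwistedSchubertClass w l S')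
    {m : WordOf N n} (hm : (S - S').1 (fixedPt m) ≠ 0) :
    ((S - S').1 (fixedPt m)).totalDegree < wordLength (permWord w⁻¹ m.1) := by
  have sub_apply : (S - S').1 (fixedPt m) = S.1 (fixedPt m) - S'.1 (fixedPt m) := rfl
  rw [sub_apply] at hm ⊢
  have hge : wordGEw w m.1 l.1 := by
    by_contra hge
    rw [not_not.1 (mt (h.support_ge m) hge), not_not.1 (mt (h'.support_ge m) hge)] at hm
    exact hm (sub_zero 0)
  have hne : permWord w⁻¹ l.1 ≠ permWord w⁻¹ m.1 := by
    refine fun heq => hm ?_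
    obtain rfl : l = m := Subtype.ext <| funext fun i => by
      simpa [permWord] using congrFun heq (w⁻¹ i)
    rw [h.value, h'.value, sub_self]
  have h0 : suffixSum 0 (permWord w⁻¹ m.1) = suffixSum 0 (permWord w⁻¹ l.1) := by
    rw [suffixSum_zero_permWord, suffixSum_zero_permWord, suffixSum_zero_eq_suffixSum_zero]
  calc (S.1 (fixedPt m) - S'.1 (fixedPt m)).totalDegree
      ≤ max (S.1 (fixedPt m)).totalDegree (S'.1 (fixedPt m)).totalDegree := totalDegree_sub _ _
    _ = wordLength (permWord w⁻¹ l.1) := by rw [h.degree m hge, h'.degree m hge, max_self]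
    _ < wordLength (permWord w⁻¹ m.1) :=
      wordLength_lt_of_suffixGE (suffixGE_of_wordGE hge h0) h0.symm hne

theorem IsTwistedSchubertClass.unique {w : Equiv.Perm (Fin N)} {l : WordOf N n} {S S' : HT N n}
    (h : IsTwistedSchubertClass w l S) (h' : IsTwistedSchubertClass w l S') : S = S' :=
  sub_eq_zero.1 (eq_zero_of_totalDegree_lt fun _ => h.totalDegree_sub_lt h')

end Classes

/-! ### Localisation at the differences -/

section Localisation

open MvPolynomial

variable {N n : ℕ}

theorem mk_sum_smul {R M ι : Type*} [CommRing R] [AddCommGroup M] [Module R M]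
    {S : Submonoid R} (u : Finset ι) (a : ι → R) (x : ι → M) (s : S) :
    LocalizedModule.mk (∑ i ∈ u, a i • x i) s =
      ∑ i ∈ u, Localization.mk (a i) s • LocalizedModule.mk (x i) 1 := by
  have mk_eq_smul (y : M) :
      LocalizedModule.mk y s = Localization.mk 1 s • LocalizedModule.mkLinearMap S M y := by
    rw [LocalizedModule.mkLinearMap_apply, LocalizedModule.mk_smul_mk, one_smul, mul_one]
  rw [mk_eq_smul, map_sum, Finset.smul_sum]
  refine Finset.sum_congr rfl fun i _ => ?_
  rw [← mk_eq_smul, LocalizedModule.mk_smul_mk, mul_one]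

theorem resLoc_mk (a : HT N n) (s : loc N) :
    resLoc N n (LocalizedModule.mk a s) = LocalizedModule.mk a.1 s :=
  LocalizedModule.map_mk _ _ _ _

/-- The product of all differences `t_a - t_b`, `a ≠ b`. Every function on the fixed points becomes
a GKM class after multiplication by it. -/
noncomputable def allDifferences (N : ℕ) : loc N :=
  ⟨∏ p : Fin N × Fin N with p.1 ≠ p.2, (X p.1 - X p.2), Submonoid.prod_mem _ fun p hp =>
    Submonoid.subset_closure ⟨p.1, p.2, (Finset.mem_filter.1 hp).2, rfl⟩⟩

theorem allDifferences_smul_mem (f : FixedPt N n → P N) :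
    (allDifferences N : P N) • f ∈ HT N n := by
  intro l m i j h
  obtain rfl | hij := eq_or_ne i j
  · obtain rfl : l = m := Subtype.ext (h.trans (permWord_swap_of_eq rfl)).symm
    rw [sub_self, sub_self]
  · rw [Pi.smul_apply, Pi.smul_apply, ← smul_sub, smul_eq_mul]
    exact (Finset.dvd_prod_of_mem (fun p : Fin N × Fin N => (X p.1 - X p.2 : P N)) (a := (i, j))
      (by simpa using hij)).mul_right _

theorem resLoc_bijective (N n : ℕ) : Function.Bijective (resLoc N n) := by
  refine ⟨LocalizedModule.map_injective _ _ Subtype.val_injective, fun x => ?_⟩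
  induction x using LocalizedModule.induction_on with | _ f s
  refine ⟨LocalizedModule.mk ⟨_, allDifferences_smul_mem f⟩ (allDifferences N * s), ?_⟩
  rw [resLoc_mk]
  exact LocalizedModule.mk_cancel_common_left _ _ _

theorem mk_eq_sum_fixedPtVec (f : FixedPt N n → P N) (s : loc N) :
    (LocalizedModule.mk f s : FuncLoc N n) =
      ∑ p, (Localization.mk (f p) s : Ploc N) • fixedPtVec p := by
  classical
  simp only [fixedPtVec, ← mk_sum_smul]
  congr 1
  ext1 q
  simp [Pi.single_apply]

end Localisation

/-! ### Bethe vectors in the spin basis -/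

section Coordinates

open MvPolynomial

variable {N n : ℕ}

theorem repr_opC (y : P N) (u : VN N) :
    ⇑((vBasis N).repr (opC y u)) = actC y X ((vBasis N).repr u) := by
  rw [← LinearMap.toMatrix_mulVec_repr (vBasis N), opC, LinearMap.toMatrix_toLin]
  rfl

theorem repr_betheVec (l : Word N) :
    ⇑((vBasis N).repr (betheVec l)) = betheCoords X (letterVals (-X) l 0) := by
  have letterVals_eq_coe : letterVals (-X : Fin N → P N) l 0 =
      ↑(((List.finRange N).filter fun i => l i = 0).map (-X : Fin N → P N)) := rfl
  rw [betheVec, letterVals_eq_coe]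
  generalize (List.finRange N).filter _ = L
  induction L with
  | nil =>
    ext m
    simp [betheCoords_zero, vacuum, Finsupp.single_apply, Pi.single_apply, eq_comm]
  | cons i L ih =>
    rw [List.map_cons, List.prod_cons, Module.End.mul_apply, repr_opC, ih, List.map_cons,
      ← Multiset.cons_coe, betheCoords_cons]
    rfl

theorem sum_eq_of_zeroCount_eq {l m : Word N} (h : zeroCount l = zeroCount m) :
    ∑ i, (l i : ℕ) = ∑ i, (m i : ℕ) := by
  have hl := zeroCount_add_suffixSum l
  have hm := zeroCount_add_suffixSum m
  rw [suffixSum_zero_wordOf ⟨l, rfl⟩] at hl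
  rw [suffixSum_zero_wordOf ⟨m, rfl⟩] at hm
  omega

theorem zeroCount_eq_zeroCount (l m : WordOf N n) : zeroCount l.1 = zeroCount m.1 := by
  have hl := zeroCount_add_suffixSum l.1
  have hm := zeroCount_add_suffixSum m.1
  rw [suffixSum_zero_wordOf] at hl hm
  omega

theorem sum_eq_of_repr_betheVec_ne_zero (l : WordOf N n) {k : Word N}
    (hk : (vBasis N).repr (betheVec l.1) k ≠ 0) : ∑ i, (k i : ℕ) = n := by
  rw [repr_betheVec] at hk
  have isHomogeneous_neg_X (i : Fin N) : ((-X : Fin N → P N) i).IsHomogeneous 1 :=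
    (isHomogeneous_X ℂ i).neg
  have hgraded := isGraded_betheCoords (isHomogeneous_X ℂ) (Y := letterVals (-X) l.1 0) <| by
    intro y hy
    obtain ⟨i, -, rfl⟩ := Multiset.mem_map.1 hy
    exact isHomogeneous_neg_X i
  refine (sum_eq_of_zeroCount_eq ((hgraded.zeroCount_eq k hk).trans ?_)).trans l.2
  rw [letterVals, Multiset.card_map]
  rfl

theorem sum_wordOf_eq_sum {M : Type*} [AddCommMonoid M] {f : Word N → M}
    (hf : ∀ k, f k ≠ 0 → ∑ i, (k i : ℕ) = n) : ∑ k : WordOf N n, f k.1 = ∑ k, f k :=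
  Fintype.sum_of_injective Subtype.val Subtype.val_injective _ _
    (fun k hk => not_not.1 (mt (hf k) fun h => hk ⟨⟨k, h⟩, rfl⟩)) fun _ => rfl

theorem exists_eq_one_eq_zero {l m : WordOf N n} (h : l ≠ m) : ∃ i, m.1 i = 1 ∧ l.1 i = 0 := by
  by_contra! hlm
  have hle (i : Fin N) (_ : i ∈ Finset.univ) : (m.1 i : ℕ) ≤ l.1 i := by
    by_cases hi : m.1 i = 1
    · have := hlm i hi
      omega
    · omega
  have heq := (Finset.sum_eq_sum_iff_of_le hle).1 (m.2.trans l.2.symm)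
  exact h (Subtype.ext (funext fun i => Fin.ext (heq i (Finset.mem_univ i)).symm))

theorem prod_zeros_prod_ones_sub (l m : WordOf N n) :
    ∏ j with l.1 j = 0, ∏ i with m.1 i = 1, (X i - X j : P N) =
      if l = m then (betheDenom l.1 : P N) else 0 := by
  split_ifs with h
  · subst h
    rw [betheDenom, Finset.prod_comm, ← Finset.prod_product']
    refine Finset.prod_congr ?_ fun _ _ => rfl
    ext p
    simp only [Finset.mem_product, Finset.mem_filter, Finset.mem_univ, true_and]
    omega
  · obtain ⟨i, hm, hl⟩ := exists_eq_one_eq_zero h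
    exact Finset.prod_eq_zero (i := i) (by simpa using hl)
      (Finset.prod_eq_zero (i := i) (by simpa using hm) (sub_self _))

theorem sum_repr_betheVec_mul_schubertValue (l m : WordOf N n) :
    ∑ k : WordOf N n, (vBasis N).repr (betheVec l.1) k.1 * schubertValue X k.1 m.1 =
      if l = m then (betheDenom l.1 : P N) else 0 := by
  rw [← prod_zeros_prod_ones_sub,
    ← complPairing_betheCoords_letterVals X (zeroCount_eq_zeroCount l m), complPairing_apply,
    ← repr_betheVec]
  exact sum_wordOf_eq_sum (f := fun k => (vBasis N).repr (betheVec l.1) k * schubertValue X k m.1)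
    fun _ hk => sum_eq_of_repr_betheVec_ne_zero l (left_ne_zero_of_mul hk)

theorem sum_repr_betheVec_smul_schubertClass (l : WordOf N n) [DecidableEq (FixedPt N n)] :
    ∑ k : WordOf N n, (vBasis N).repr (betheVec l.1) k.1 • (schubertClass k).1 =
      betheDenom l.1 • Pi.single (fixedPt l) 1 := by
  ext1 p
  obtain ⟨m, rfl⟩ := fixedPt_surjective p
  simp only [Finset.sum_apply, Pi.smul_apply, smul_eq_mul, schubertClass_fixedPt,
    sum_repr_betheVec_mul_schubertValue, Submonoid.smul_def, Pi.single_apply,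
    fixedPt_injective.eq_iff, eq_comm (a := m)]
  rw [mul_ite, mul_one, mul_zero]

end Coordinates

/-! ### The isomorphism `Ψ` -/

section Iso

variable {N : ℕ}

/-- The number of letters `1` of a word, the index of its summand in the target of `Ψ`. -/
def oneCount (l : Word N) : Fin (N + 1) :=
  ⟨∑ i, (l i : ℕ), by
    rw [sum_word_eq_card]
    exact Nat.lt_succ_of_le ((Fintype.card_subtype_le _).trans_eq (Fintype.card_fin N))⟩

/-- The spin basis `v_λ`, as a basis of the localised module. -/
noncomputable def vLocBasis (N : ℕ) : Module.Basis (Word N) (Ploc N) (VNloc N) :=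
  (vBasis N).ofIsLocalizedModule (Ploc N) (loc N) (LocalizedModule.mkLinearMap (loc N) (VN N))

theorem vLocBasis_apply (l : Word N) :
    vLocBasis N l = LocalizedModule.mk (vBasis N l) 1 := by
  rw [vLocBasis, Module.Basis.ofIsLocalizedModule_apply, LocalizedModule.mkLinearMap_apply]

/-- The linear map `Ψ` with `v_λ ↦ S^{ω₀}_λ`. -/
noncomputable def psi (N : ℕ) :
    VNloc N →ₗ[Ploc N] DirectSum (Fin (N + 1)) fun n => HTloc N n :=
  (vLocBasis N).constr (Ploc N) fun l =>
    DirectSum.lof (Ploc N) (Fin (N + 1)) (fun n => HTloc N n) (oneCount l)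
      (LocalizedModule.mk (schubertClass ⟨l, rfl⟩) 1)

theorem psi_mk_vBasis (n : Fin (N + 1)) (l : WordOf N n) :
    psi N (LocalizedModule.mk (vBasis N l.1) 1) =
      DirectSum.lof (Ploc N) (Fin (N + 1)) (fun n => HTloc N n) n
        (LocalizedModule.mk (schubertClass l) 1) := by
  obtain ⟨l, hl⟩ := l
  obtain rfl : oneCount l = n := Fin.ext hl
  rw [← vLocBasis_apply, psi, Module.Basis.constr_basis]

theorem psi_mk (n : Fin (N + 1)) {u : VN N}
    (hu : ∀ k, (vBasis N).repr u k ≠ 0 → ∑ i, (k i : ℕ) = n) (s : loc N) :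
    psi N (LocalizedModule.mk u s) =
      DirectSum.lof (Ploc N) (Fin (N + 1)) (fun n => HTloc N n) n
        (LocalizedModule.mk (∑ k : WordOf N n, (vBasis N).repr u k.1 • schubertClass k) s) := by
  conv_lhs => rw [← (vBasis N).sum_repr u]
  rw [mk_sum_smul, ← sum_wordOf_eq_sum (n := n), mk_sum_smul, map_sum, map_sum]
  · exact Finset.sum_congr rfl fun k _ => by rw [map_smul, map_smul, psi_mk_vBasis]
  · refine fun k hk => hu k fun h0 => hk ?_
    rw [h0, Localization.mk_zero, zero_smul]

theorem lmap_resLoc_psi_normBetheVec (n : Fin (N + 1)) (l : WordOf N n) :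
    DirectSum.lmap (fun n : Fin (N + 1) => resLoc N n) (psi N (normBetheVec l.1)) =
      DirectSum.lof (Ploc N) (Fin (N + 1)) (fun n => FuncLoc N n) n (fixedPtVec (fixedPt l)) := by
  classical
  have coe_sum : (∑ k : WordOf N n, (vBasis N).repr (betheVec l.1) k.1 • schubertClass k).1 =
      betheDenom l.1 • Pi.single (fixedPt l) 1 := by
    rw [← sum_repr_betheVec_smul_schubertClass, ← Submodule.subtype_apply, map_sum]
    rfl
  rw [normBetheVec, psi_mk n fun _ => sum_eq_of_repr_betheVec_ne_zero l, DirectSum.lmap_lof,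
    resLoc_mk, coe_sum, LocalizedModule.mk_cancel, fixedPtVec]

theorem lmap_resLoc_psi_surjective :
    Function.Surjective (DirectSum.lmap (fun n : Fin (N + 1) => resLoc N n) ∘ₗ psi N) := by
  rw [← LinearMap.range_eq_top, eq_top_iff]
  rintro x -
  induction x using DirectSum.induction_on with
  | zero => exact Submodule.zero_mem _
  | add x y hx hy => exact Submodule.add_mem _ hx hy
  | of n x =>
    change DirectSum.lof (Ploc N) (Fin (N + 1)) (fun n => FuncLoc N n) n x ∈ _
    induction x using LocalizedModule.induction_on with | _ f s
    rw [mk_eq_sum_fixedPtVec, map_sum]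
    refine Submodule.sum_mem _ fun p _ => ?_
    rw [map_smul]
    obtain ⟨l, rfl⟩ := fixedPt_surjective p
    exact Submodule.smul_mem _ _ ⟨normBetheVec l.1, lmap_resLoc_psi_normBetheVec n l⟩

/-- Words correspond to the torus fixed points of all Grassmannians. -/
noncomputable def wordEquivFixedPts (N : ℕ) : Word N ≃ Σ n : Fin (N + 1), FixedPt N n :=
  (Equiv.sigmaFiberEquiv oneCount).symm.trans <| Equiv.sigmaCongrRight fun n =>
    (Equiv.subtypeEquivRight fun _ => Fin.ext_iff).trans (fixedPtEquiv N n)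

/-- The isomorphism `v_λ ↦ 𝟙_{w_λ}` of free modules, which serves only to compare ranks. -/
noncomputable def vLocEquivFuncLoc (N : ℕ) :
    VNloc N ≃ₗ[Ploc N] DirectSum (Fin (N + 1)) fun n => FuncLoc N n :=
  (vLocBasis N).equiv
    (DFinsupp.basis fun n : Fin (N + 1) => (Pi.basisFun (P N) (FixedPt N n)).ofIsLocalizedModule
      (Ploc N) (loc N) (LocalizedModule.mkLinearMap (loc N) (FixedPt N n → P N)))
    (wordEquivFixedPts N)

theorem lmap_resLoc_bijective :
    Function.Bijective (DirectSum.lmap fun n : Fin (N + 1) => resLoc N n) :=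
  ⟨(DirectSum.lmap_injective _).2 fun n => (resLoc_bijective N n).1,
    (DirectSum.lmap_surjective _).2 fun n => (resLoc_bijective N n).2⟩

theorem psi_bijective : Function.Bijective (psi N) := by
  have : Module.Finite (Ploc N) (DirectSum (Fin (N + 1)) fun n => FuncLoc N n) :=
    Module.Finite.of_basis ((vLocBasis N).map (vLocEquivFuncLoc N))
  refine (lmap_resLoc_bijective.of_comp_iff' _).1 ?_
  exact OrzechProperty.bijective_of_surjective_of_injective
    (vLocEquivFuncLoc N).toLinearMap _ (vLocEquivFuncLoc N).injective lmap_resLoc_psi_surjective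

end Iso

end BetheGr

theorem corollary3p11 (N : ℕ) (_hN : 2 ≤ N) :
    ∃ S : ∀ n : Fin (N + 1), BetheGr.WordOf N n → BetheGr.HT N n,
      -- `S n λ` is the twisted Schubert class of `λ` for the longest permutation,
      -- the unique class with the characterising properties
      (∀ n l, BetheGr.IsTwistedSchubertClass Fin.revPerm l (S n l) ∧
        ∀ S', BetheGr.IsTwistedSchubertClass Fin.revPerm l S' → S' = S n l) ∧
      -- restriction to the fixed points identifies the localised cohomologies
      (∀ n : Fin (N + 1), Function.Bijective (BetheGr.resLoc N n)) ∧
      ∃ Ψ : BetheGr.VNloc N ≃ₗ[BetheGr.Ploc N]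
          (DirectSum (Fin (N + 1)) fun n => BetheGr.HTloc N n),
        -- `Ψ` is the unique linear map with `Ψ (v_λ) = S_λ`
        (∀ (n : Fin (N + 1)) (l : BetheGr.WordOf N n),
          Ψ (LocalizedModule.mk (BetheGr.vBasis N l.1) 1) =
            DirectSum.lof (BetheGr.Ploc N) (Fin (N + 1)) (fun n => BetheGr.HTloc N n) n
              (LocalizedModule.mk (S n l) 1)) ∧
        (∀ Φ : BetheGr.VNloc N →ₗ[BetheGr.Ploc N]
            (DirectSum (Fin (N + 1)) fun n => BetheGr.HTloc N n),
          (∀ (n : Fin (N + 1)) (l : BetheGr.WordOf N n),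
            Φ (LocalizedModule.mk (BetheGr.vBasis N l.1) 1) =
              DirectSum.lof (BetheGr.Ploc N) (Fin (N + 1)) (fun n => BetheGr.HTloc N n) n
                (LocalizedModule.mk (S n l) 1)) → Φ = Ψ.toLinearMap) ∧
        -- `Ψ` sends the normalised Bethe vectors to the fixed point basis vectors
        (∀ (n : Fin (N + 1)) (l : BetheGr.WordOf N n),
          DirectSum.lmap (fun n : Fin (N + 1) => BetheGr.resLoc N n)
              (Ψ (BetheGr.normBetheVec l.1)) =
            DirectSum.lof (BetheGr.Ploc N) (Fin (N + 1)) (fun n => BetheGr.FuncLoc N n) n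
              (BetheGr.fixedPtVec (BetheGr.fixedPt l))) := by
  refine ⟨fun n l => BetheGr.schubertClass l, fun n l =>
    ⟨BetheGr.isTwistedSchubertClass_schubertClass l, fun S' hS' =>
      hS'.unique (BetheGr.isTwistedSchubertClass_schubertClass l)⟩,
    fun n => BetheGr.resLoc_bijective N n,
    LinearEquiv.ofBijective (BetheGr.psi N) BetheGr.psi_bijective,
    BetheGr.psi_mk_vBasis, fun Φ hΦ => ?_, BetheGr.lmap_resLoc_psi_normBetheVec⟩
  refine (BetheGr.vLocBasis N).ext fun l => ?_
  rw [BetheGr.vLocBasis_apply]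
  exact (hΦ (BetheGr.oneCount l) ⟨l, rfl⟩).trans
    (BetheGr.psi_mk_vBasis (BetheGr.oneCount l) ⟨l, rfl⟩).symm
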